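/- Let $k$ be a field and let $E=(E^0,E^1,s,r)$ and $F=(F^0,F^1,s,r)$ be finite directed graphs with no sinks (every vertex is the source of at least one edge). For such a graph $G$ let $kG^0$ be the $k$-algebra with basis $G^0$ and product $vw=\delta_{v,w}v$, let $kG^1$ be the $kG^0$–$kG^0$-bimodule with basis $G^1$ and actions $v\cdot e=\delta_{v,s(e)}e$, $e\cdot w=\delta_{w,r(e)}e$, and let $(kG^1)^{\otimes m}$ ($m\ge 1$) be its tensor powers over $kG^0$. Let $$\nu_m^G: kG^1\otimes_{kG^0}(kG^1)^{\otimes m}\to (kG^1)^{\otimes m}\otimes_{kG^0}kG^1,\qquad x\otimes(y_1\otimes\cdots\otimes y_m)\mapsto (x\otimes y_1\otimes\cdots\otimes y_{m-1})\otimes y_m .$$ Bimodules over $k$-algebras are assumed to have the same $k$-action on both sides. Let $L_k(G)$ be the Leavitt path algebra of $G$, i.e. the $k$-algebra generated by $v$ ($v\in G^0$) and $e,e^*$ ($e\in G^1$) subject to $vw=\delta_{v,w}v$, $s(e)e=er(e)=e$, $r(e)e^*=e^*s(e)=e^*$, $e^*f=\delta_{e,f}r(e)$ and $v=\sum_{s(e)=v}ee^*$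 for every $v$ that emits an edge (its identity is $\sum_{v}v$), with its standard $\mathbb Z$-grading, in which degree $n$ is spanned by the $\alpha\beta^*$ with $\alpha,\beta$ paths of the same range and $\ell(\alpha)-\ell(\beta)=n$. For bimodule isomorphisms $\sigma:kE^1\otimes_{kE^0}M\to M\otimes_{kF^0}kF^1$ and $\psi:kF^1\otimes_{kF^0}N\to N\otimes_{kG^0}kG^1$ let $$\sigma\#\psi: kE^1\otimes_{kE^0}(M\otimes_{kF^0}N)\to(M\otimes_{kF^0}N)\otimes_{kG^0}kG^1$$ be the composite $(\mathrm{id}_M\otimes\psi)\circ(\sigma\otimes\mathrm{id}_N)$, with the associativity isomorphisms inserted. The bridging bimodule $Y_{(M,\sigma)}$ is the right $L_k(F)$-module $M\otimes_{kF^0}L_k(F)$ with the left $L_k(E)$-action determined by $v\cdot(m\otimes S)=vm\otimes S$; $e\cdot(m\otimes S)=\sum_i m_i\otimes y_iS$ if $\sigma(e\otimes m)=\sum_i m_i\otimes y_i$; and $e^*\cdot(m\otimes S)=\sum_{f\in F^1}\sum_i(e^*x_i^f)m_i^f\otimes f^*S$ if $\sigma^{-1}(m\otimes f)=\sum_i x_i^f\otimes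 m_i^f$ for each $f\in F^1$, where for $x\in kE^1$ the element $e^*x\in kE^0$ is the coefficient of $x$ at $e$ times $r(e)$. For a $\mathbb Z$-graded ring $R$, let $\mathsf{Mod}\text{-}R$ be the category of right $R$-modules and $\mathsf{Gr}\text{-}R$ the category of $\mathbb Z$-graded right $R$-modules and degree-preserving homomorphisms, with suspensions $M(\gamma)_i=M_{\gamma+i}$. A functor $\mathsf{Gr}\text{-}R\to\mathsf{Gr}\text{-}S$ is graded if it commutes with all suspensions, and is a graded equivalence if moreover it has a graded quasi-inverse. A functor $\varphi:\mathsf{Mod}\text{-}R\to\mathsf{Mod}\text{-}S$ is graded if some graded functor $\Phi:\mathsf{Gr}\text{-}R\to\mathsf{Gr}\text{-}S$ satisfies $U_S\circ\Phi=\varphi\circ U_R$ for the forgetful functors $U_R, U_S$, and is a graded equivalence if moreover it is an equivalence of categories. The rings $R$ and $S$ are graded Morita equivalent if there are a graded equivalence $\mathsf{Mod}\text{-}R\to\mathsf{Mod}\text{-}S$ and a graded equivalence $\mathsf{Gr}\text{-}R\to\mathsf{Gr}\text{-}S$ (each of the two is known to imply the other). **Theorem.** Let $M$ be a $kE^0$–$kF^0$-bimodule,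 $N$ a $kF^0$–$kE^0$-bimodule and $n$ a positive integer, and suppose there are bimodule isomorphisms $$\omega_E:M\otimes_{kF^0}N\to(kE^1)^{\otimes n},\quad \omega_F:N\otimes_{kE^0}M\to(kF^1)^{\otimes n},$$ $$\sigma_M:kE^1\otimes_{kE^0}M\to M\otimes_{kF^0}kF^1,\quad \sigma_N:kF^1\otimes_{kF^0}N\to N\otimes_{kE^0}kE^1$$ such that $$\nu_n^E\circ(\mathrm{id}\otimes\omega_E)=(\omega_E\otimes\mathrm{id})\circ(\sigma_M\#\sigma_N)\quad\text{and}\quad \nu_n^F\circ(\mathrm{id}\otimes\omega_F)=(\omega_F\otimes\mathrm{id})\circ(\sigma_N\#\sigma_M).$$ Then $L_k(E)$ and $L_k(F)$ are graded Morita equivalent. Moreover, the functor $-\otimes_{L_k(E)}Y_{(M,\sigma_M)}:\mathsf{Mod}\text{-}L_k(E)\to\mathsf{Mod}\text{-}L_k(F)$ is a graded equivalence. -/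

import Mathlib

open CategoryTheory MulOpposite
open scoped TensorProduct

universe u

/-! # Tensor products over a noncommutative ring -/

/-- The tensor product `X ⊗_R Y` of a right `R`-module `X` and a left `R`-module `Y`: the quotient of
`X ⊗_ℤ Y` by the subgroup generated by the elements `xr ⊗ y - x ⊗ ry`. -/
def RTensor (R X Y : Type u) [Ring R] [AddCommGroup X] [Module Rᵐᵒᵖ X]
    [AddCommGroup Y] [Module R Y] : Type u :=
  (X ⊗[ℤ] Y) ⧸ AddSubgroup.closure
    {z : X ⊗[ℤ] Y | ∃ (x : X) (r : R) (y : Y), z = (op r • x) ⊗ₜ[ℤ] y - x ⊗ₜ[ℤ] (r • y)}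

namespace RTensor

noncomputable instance instAddCommGroup (R X Y : Type u) [Ring R] [AddCommGroup X] [Module Rᵐᵒᵖ X]
    [AddCommGroup Y] [Module R Y] : AddCommGroup (RTensor R X Y) :=
  inferInstanceAs (AddCommGroup ((X ⊗[ℤ] Y) ⧸ AddSubgroup.closure
    {z : X ⊗[ℤ] Y | ∃ (x : X) (r : R) (y : Y), z = (op r • x) ⊗ₜ[ℤ] y - x ⊗ₜ[ℤ] (r • y)}))

section

variable (R : Type u) {X X' X'' Y Y' Y'' : Type u} [Ring R]
variable [AddCommGroup X] [Module Rᵐᵒᵖ X] [AddCommGroup Y] [Module R Y]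
variable [AddCommGroup X'] [Module Rᵐᵒᵖ X'] [AddCommGroup Y'] [Module R Y']
variable [AddCommGroup X''] [Module Rᵐᵒᵖ X''] [AddCommGroup Y''] [Module R Y'']

/-- The pure tensor `x ⊗ y`. -/
noncomputable def tmul (x : X) (y : Y) : RTensor R X Y :=
  QuotientAddGroup.mk (x ⊗ₜ[ℤ] y)

theorem add_tmul (x x' : X) (y : Y) : tmul R (x + x') y = tmul R x y + tmul R x' y := by
  unfold tmul
  rw [TensorProduct.add_tmul]
  rfl

theorem tmul_add (x : X) (y y' : Y) : tmul R x (y + y') = tmul R x y + tmul R x y' := by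
  unfold tmul
  rw [TensorProduct.tmul_add]
  rfl

theorem zero_tmul (y : Y) : tmul R (0 : X) y = 0 := by
  unfold tmul
  rw [TensorProduct.zero_tmul]
  rfl

theorem tmul_zero (x : X) : tmul R x (0 : Y) = 0 := by
  unfold tmul
  rw [TensorProduct.tmul_zero]
  rfl

theorem smul_tmul (r : R) (x : X) (y : Y) : tmul R (op r • x) y = tmul R x (r • y) := by
  unfold tmul
  refine QuotientAddGroup.eq.mpr ?_
  rw [neg_add_eq_sub, ← neg_mem_iff, neg_sub]
  exact AddSubgroup.subset_closure ⟨x, r, y, rfl⟩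

theorem tmul_sum {ι : Type*} (s : Finset ι) (x : X) (f : ι → Y) :
    tmul R x (∑ i ∈ s, f i) = ∑ i ∈ s, tmul R x (f i) := by
  classical
  induction s using Finset.induction_on with
  | empty => simp [tmul_zero]
  | insert a s ha ih => rw [Finset.sum_insert ha, Finset.sum_insert ha, tmul_add, ih]

theorem sum_tmul {ι : Type*} (s : Finset ι) (f : ι → X) (y : Y) :
    tmul R (∑ i ∈ s, f i) y = ∑ i ∈ s, tmul R (f i) y := by
  classical
  induction s using Finset.induction_on with
  | empty => simp [zero_tmul]
  | insert a s ha ih => rw [Finset.sum_insert ha, Finset.sum_insert ha, add_tmul, ih]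

variable {R} in
theorem induction {p : RTensor R X Y → Prop} (h0 : p 0) (ht : ∀ x y, p (tmul R x y))
    (ha : ∀ z w, p z → p w → p (z + w)) (z : RTensor R X Y) : p z := by
  obtain ⟨z, rfl⟩ := QuotientAddGroup.mk_surjective z
  induction z using TensorProduct.induction_on with
  | zero => exact h0
  | tmul x y => exact ht x y
  | add z w hz hw => exact ha _ _ hz hw

/-- The additive map out of `X ⊗_R Y` given by an `R`-balanced biadditive map. -/
noncomputable def lift {P : Type u} [AddCommGroup P] (f : X →+ Y →+ P)
    (h : ∀ (x : X) (r : R) (y : Y), f (op r • x) y = f x (r • y)) : RTensor R X Y →+ P :=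
  QuotientAddGroup.lift _ (TensorProduct.liftAddHom f (fun n x y => by simp)) (by
    rw [AddSubgroup.closure_le]
    rintro _ ⟨x, r, y, rfl⟩
    simp [h])

@[simp] theorem lift_tmul {P : Type u} [AddCommGroup P] (f : X →+ Y →+ P)
    (h : ∀ (x : X) (r : R) (y : Y), f (op r • x) y = f x (r • y)) (x : X) (y : Y) :
    lift R f h (tmul R x y) = f x y := rfl

/-- The map `f ⊗ g`. -/
noncomputable def map (f : X →ₗ[Rᵐᵒᵖ] X') (g : Y →ₗ[R] Y') : RTensor R X Y →+ RTensor R X' Y' :=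
  lift R
    (AddMonoidHom.mk' (fun x => AddMonoidHom.mk' (fun y => tmul R (f x) (g y))
        (fun y y' => by rw [map_add, tmul_add]))
      (fun x x' => by ext y; simp [add_tmul]))
    (fun x r y => by simp [smul_tmul])

@[simp] theorem map_tmul (f : X →ₗ[Rᵐᵒᵖ] X') (g : Y →ₗ[R] Y') (x : X) (y : Y) :
    map R f g (tmul R x y) = tmul R (f x) (g y) := rfl

theorem map_id (z : RTensor R X Y) :
    map R (LinearMap.id : X →ₗ[Rᵐᵒᵖ] X) (LinearMap.id : Y →ₗ[R] Y) z = z := by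
  induction z using induction with
  | h0 => simp
  | ht x y => simp
  | ha z w hz hw => rw [map_add, hz, hw]

theorem map_comp (f : X →ₗ[Rᵐᵒᵖ] X') (f' : X' →ₗ[Rᵐᵒᵖ] X'') (g : Y →ₗ[R] Y') (g' : Y' →ₗ[R] Y'')
    (z : RTensor R X Y) : map R (f' ∘ₗ f) (g' ∘ₗ g) z = map R f' g' (map R f g z) := by
  induction z using induction with
  | h0 => simp
  | ht x y => simp
  | ha z w hz hw => simp only [map_add, hz, hw]

/-- The left `A`-action `a(x ⊗ y) = ax ⊗ y`, for an `A`-`R`-bimodule `X`. -/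
@[reducible] noncomputable def leftModule (A : Type u) [Ring A] [Module A X]
    [SMulCommClass A Rᵐᵒᵖ X] : Module A (RTensor R X Y) where
  smul a := map R (DistribSMul.toLinearMap Rᵐᵒᵖ X a) LinearMap.id
  one_smul z := by
    change map R _ _ z = z
    induction z using induction with
    | h0 => simp
    | ht x y => simp
    | ha z w hz hw => rw [map_add, hz, hw]
  mul_smul a b z := by
    change map R _ _ z = map R _ _ (map R _ _ z)
    induction z using induction with
    | h0 => simp
    | ht x y => simp [mul_smul]
    | ha z w hz hw => simp only [map_add, hz, hw]
  smul_zero a := by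
    change map R _ _ 0 = 0
    simp
  smul_add a z w := by
    change map R _ _ (z + w) = map R _ _ z + map R _ _ w
    simp
  add_smul a b z := by
    change map R _ _ z = map R _ _ z + map R _ _ z
    induction z using induction with
    | h0 => simp
    | ht x y => simp [add_smul, add_tmul]
    | ha z w hz hw => simp only [map_add, hz, hw]; abel
  zero_smul z := by
    change map R _ _ z = 0
    induction z using induction with
    | h0 => simp
    | ht x y => simp [zero_tmul]
    | ha z w hz hw => simp only [map_add, hz, hw, add_zero]

/-- The right `C`-action `(x ⊗ y)c = x ⊗ yc`, for an `R`-`C`-bimodule `Y`. -/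
@[reducible] noncomputable def rightModule (C : Type u) [Ring C] [Module Cᵐᵒᵖ Y]
    [SMulCommClass R Cᵐᵒᵖ Y] : Module Cᵐᵒᵖ (RTensor R X Y) :=
  letI : SMulCommClass Cᵐᵒᵖ R Y := SMulCommClass.symm _ _ _
  { smul := fun c => map R LinearMap.id (DistribSMul.toLinearMap R Y c)
    one_smul := fun z => by
      change map R _ _ z = z
      induction z using induction with
      | h0 => simp
      | ht x y => simp
      | ha z w hz hw => rw [map_add, hz, hw]
    mul_smul := fun a b z => by
      change map R _ _ z = map R _ _ (map R _ _ z)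
      induction z using induction with
      | h0 => simp
      | ht x y => simp [mul_smul]
      | ha z w hz hw => simp only [map_add, hz, hw]
    smul_zero := fun a => by
      change map R _ _ 0 = 0
      simp
    smul_add := fun a z w => by
      change map R _ _ (z + w) = map R _ _ z + map R _ _ w
      simp
    add_smul := fun a b z => by
      change map R _ _ z = map R _ _ z + map R _ _ z
      induction z using induction with
      | h0 => simp
      | ht x y => simp [add_smul, tmul_add]
      | ha z w hz hw => simp only [map_add, hz, hw]; abel
    zero_smul := fun z => by
      change map R _ _ z = 0
      induction z using induction with
      | h0 => simp
      | ht x y => simp [tmul_zero]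
      | ha z w hz hw => simp only [map_add, hz, hw, add_zero] }

end

end RTensor

/-! # Bimodules -/

/-- An `A`-`B`-bimodule for `k`-algebras `A` and `B` (with `k` acting centrally). A right `B`-module
is a module over the opposite ring, so `mb` is written `op b • m`. -/
structure Bimodule (k A B : Type u) [CommRing k] [Ring A] [Ring B] [Algebra k A] [Algebra k B] where
  carrier : Type u
  [addCommGroup : AddCommGroup carrier]
  [leftModule : Module A carrier]
  [rightModule : Module Bᵐᵒᵖ carrier]
  [smulComm : SMulCommClass A Bᵐᵒᵖ carrier]
  central : ∀ (c : k) (x : carrier), algebraMap k A c • x = op (algebraMap k B c) • x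

namespace Bimodule

attribute [instance] addCommGroup leftModule rightModule smulComm

instance (k A B : Type u) [CommRing k] [Ring A] [Ring B] [Algebra k A] [Algebra k B] :
    CoeSort (Bimodule k A B) (Type u) := ⟨carrier⟩

/-- Isomorphisms of `A`-`B`-bimodules. -/
structure Equiv {k A B : Type u} [CommRing k] [Ring A] [Ring B] [Algebra k A] [Algebra k B]
    (X Y : Bimodule k A B) extends X ≃+ Y where
  map_lsmul : ∀ (a : A) (x : X), toFun (a • x) = a • toFun x
  map_rsmul : ∀ (b : Bᵐᵒᵖ) (x : X), toFun (b • x) = b • toFun x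

/-- Bimodule isomorphisms from `X` to `Y`. -/
infix:25 " ≃ᵇ " => Bimodule.Equiv

section

variable {k A B C D : Type u} [CommRing k] [Ring A] [Ring B] [Ring C] [Ring D]
  [Algebra k A] [Algebra k B] [Algebra k C] [Algebra k D]

namespace Equiv

variable {X Y Z : Bimodule k A B}

instance : CoeFun (X ≃ᵇ Y) (fun _ => X → Y) := ⟨fun f => f.toFun⟩

theorem apply_add (f : X ≃ᵇ Y) (x y : X) : f (x + y) = f x + f y := f.toAddEquiv.map_add x y

theorem apply_zero (f : X ≃ᵇ Y) : f 0 = 0 := f.toAddEquiv.map_zero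

theorem apply_sum (f : X ≃ᵇ Y) {ι : Type*} (s : Finset ι) (g : ι → X) :
    f (∑ i ∈ s, g i) = ∑ i ∈ s, f (g i) := map_sum f.toAddEquiv g s

/-- The identity. -/
def refl (X : Bimodule k A B) : X ≃ᵇ X where
  __ := AddEquiv.refl X
  map_lsmul _ _ := rfl
  map_rsmul _ _ := rfl

/-- The inverse. -/
def symm (f : X ≃ᵇ Y) : Y ≃ᵇ X where
  __ := f.toAddEquiv.symm
  map_lsmul a y := f.toAddEquiv.injective <| by
    change f.toAddEquiv (f.toAddEquiv.symm (a • y)) = f (a • f.toAddEquiv.symm y)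
    rw [f.map_lsmul]
    change _ = a • f.toAddEquiv (f.toAddEquiv.symm y)
    simp
  map_rsmul a y := f.toAddEquiv.injective <| by
    change f.toAddEquiv (f.toAddEquiv.symm (a • y)) = f (a • f.toAddEquiv.symm y)
    rw [f.map_rsmul]
    change _ = a • f.toAddEquiv (f.toAddEquiv.symm y)
    simp

/-- The composition `g ∘ f`. -/
def trans (f : X ≃ᵇ Y) (g : Y ≃ᵇ Z) : X ≃ᵇ Z where
  __ := f.toAddEquiv.trans g.toAddEquiv
  map_lsmul a x := by
    change g (f (a • x)) = a • g (f x)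
    rw [f.map_lsmul, g.map_lsmul]
  map_rsmul a x := by
    change g (f (a • x)) = a • g (f x)
    rw [f.map_rsmul, g.map_rsmul]

theorem apply_symm (f : X ≃ᵇ Y) (y : Y) : f (f.symm y) = y := f.toAddEquiv.apply_symm_apply y

theorem symm_apply (f : X ≃ᵇ Y) (x : X) : f.symm (f x) = x := f.toAddEquiv.symm_apply_apply x

/-- The underlying map of left modules. -/
def toLeft (f : X ≃ᵇ Y) : X →ₗ[A] Y where
  toFun := f
  map_add' := f.apply_add
  map_smul' := f.map_lsmul

/-- The underlying map of right modules. -/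
def toRight (f : X ≃ᵇ Y) : X →ₗ[Bᵐᵒᵖ] Y where
  toFun := f
  map_add' := f.apply_add
  map_smul' := f.map_rsmul

end Equiv

/-- The tensor product `X ⊗_B Y` of an `A`-`B`-bimodule and a `B`-`C`-bimodule. -/
noncomputable def tensor (X : Bimodule k A B) (Y : Bimodule k B C) : Bimodule k A C :=
  letI : Module A (RTensor B X Y) := RTensor.leftModule B A
  letI : Module Cᵐᵒᵖ (RTensor B X Y) := RTensor.rightModule B C
  { carrier := RTensor B X Y
    smulComm := ⟨fun a c z => by
      induction z using RTensor.induction with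
      | h0 => simp
      | ht x y => rfl
      | ha z w hz hw => simp only [smul_add, hz, hw]⟩
    central := fun c z => by
      induction z using RTensor.induction with
      | h0 => simp
      | ht x y =>
        change RTensor.tmul B (algebraMap k A c • x) y = RTensor.tmul B x (op (algebraMap k C c) • y)
        rw [X.central, RTensor.smul_tmul, Y.central]
      | ha z w hz hw => simp only [smul_add, hz, hw] }

/-- Tensor product of bimodules over the middle ring. -/
infixl:70 " ⊠ " => Bimodule.tensor

/-- The pure tensor `x ⊗ y` in the bimodule `X ⊗_B Y`. -/
noncomputable def tmul {X : Bimodule k A B} {Y : Bimodule k B C} (x : X) (y : Y) :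
    (X ⊠ Y : Bimodule k A C) :=
  RTensor.tmul B x y

section API

variable {X : Bimodule k A B} {Y : Bimodule k B C}

theorem lsmul_tmul (a : A) (x : X) (y : Y) : a • tmul x y = tmul (a • x) y := rfl

theorem rsmul_tmul (c : Cᵐᵒᵖ) (x : X) (y : Y) : c • tmul x y = tmul x (c • y) := rfl

theorem tmul_balanced (b : B) (x : X) (y : Y) : tmul (op b • x) y = tmul x (b • y) :=
  RTensor.smul_tmul B b x y

theorem tensor_induction {p : (X ⊠ Y : Bimodule k A C) → Prop} (h0 : p 0) (ht : ∀ x y, p (tmul x y))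
    (ha : ∀ z w, p z → p w → p (z + w)) (z : (X ⊠ Y : Bimodule k A C)) : p z :=
  RTensor.induction h0 ht ha z

theorem add_tmul (x x' : X) (y : Y) : tmul (x + x') y = tmul x y + tmul x' y :=
  RTensor.add_tmul B x x' y

theorem tmul_add (x : X) (y y' : Y) : tmul x (y + y') = tmul x y + tmul x y' :=
  RTensor.tmul_add B x y y'

theorem zero_tmul (y : Y) : tmul (0 : X) y = 0 := RTensor.zero_tmul B y

theorem tmul_zero (x : X) : tmul x (0 : Y) = 0 := RTensor.tmul_zero B x

theorem tmul_sum {ι : Type*} (s : Finset ι) (x : X) (f : ι → Y) :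
    tmul x (∑ i ∈ s, f i) = ∑ i ∈ s, tmul x (f i) := RTensor.tmul_sum B s x f

theorem sum_tmul {ι : Type*} (s : Finset ι) (f : ι → X) (y : Y) :
    tmul (∑ i ∈ s, f i) y = ∑ i ∈ s, tmul (f i) y := RTensor.sum_tmul B s f y

/-- The additive map out of `X ⊗_B Y` given by a balanced biadditive function. -/
noncomputable def tensorLift {P : Type u} [AddCommGroup P] (f : X → Y → P)
    (hl : ∀ x x' y, f (x + x') y = f x y + f x' y) (hr : ∀ x y y', f x (y + y') = f x y + f x y')
    (hb : ∀ (x : X) (b : B) (y : Y), f (op b • x) y = f x (b • y)) :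
    (X ⊠ Y : Bimodule k A C) →+ P :=
  RTensor.lift B (AddMonoidHom.mk' (fun x => AddMonoidHom.mk' (f x) (hr x))
    (fun x x' => by ext y; exact hl x x' y)) hb

theorem tensorLift_tmul {P : Type u} [AddCommGroup P] (f : X → Y → P)
    (hl : ∀ x x' y, f (x + x') y = f x y + f x' y) (hr : ∀ x y y', f x (y + y') = f x y + f x y')
    (hb : ∀ (x : X) (b : B) (y : Y), f (op b • x) y = f x (b • y)) (x : X) (y : Y) :
    tensorLift f hl hr hb (tmul x y) = f x y := rfl

theorem tensor_hom_ext {P : Type u} [AddCommGroup P] {F G : (X ⊠ Y : Bimodule k A C) →+ P}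
    (h : ∀ x y, F (tmul x y) = G (tmul x y)) (z : (X ⊠ Y : Bimodule k A C)) : F z = G z := by
  induction z using tensor_induction with
  | h0 => simp
  | ht x y => exact h x y
  | ha z w hz hw => simp only [map_add, hz, hw]

theorem tensor_map_lsmul {Z : Bimodule k A D} (F : (X ⊠ Y : Bimodule k A C) →+ Z)
    (h : ∀ (a : A) x y, F (tmul (a • x) y) = a • F (tmul x y)) (a : A)
    (z : (X ⊠ Y : Bimodule k A C)) : F (a • z) = a • F z := by
  induction z using tensor_induction with
  | h0 => simp
  | ht x y => exact h a x y
  | ha z w hz hw => simp only [smul_add, map_add, hz, hw]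

theorem tensor_map_rsmul {Z : Bimodule k D C} (F : (X ⊠ Y : Bimodule k A C) →+ Z)
    (h : ∀ (c : Cᵐᵒᵖ) x y, F (tmul x (c • y)) = c • F (tmul x y)) (c : Cᵐᵒᵖ)
    (z : (X ⊠ Y : Bimodule k A C)) : F (c • z) = c • F z := by
  induction z using tensor_induction with
  | h0 => simp
  | ht x y => exact h c x y
  | ha z w hz hw => simp only [smul_add, map_add, hz, hw]

end API

/-- The additive map `f ⊗ g` underlying `tensorCongr`. -/
noncomputable def tensorMap {X X' : Bimodule k A B} {Y Y' : Bimodule k B C} (f : X ≃ᵇ X')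
    (g : Y ≃ᵇ Y') : (X ⊠ Y : Bimodule k A C) →+ (X' ⊠ Y' : Bimodule k A C) :=
  RTensor.map B f.toRight g.toLeft

theorem tensorMap_tmul {X X' : Bimodule k A B} {Y Y' : Bimodule k B C} (f : X ≃ᵇ X')
    (g : Y ≃ᵇ Y') (x : X) (y : Y) : tensorMap f g (tmul x y) = tmul (f x) (g y) := rfl

/-- The isomorphism `f ⊗ g`. -/
noncomputable def tensorCongr {X X' : Bimodule k A B} {Y Y' : Bimodule k B C} (f : X ≃ᵇ X')
    (g : Y ≃ᵇ Y') : (X ⊠ Y : Bimodule k A C) ≃ᵇ (X' ⊠ Y' : Bimodule k A C) where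
  toFun := tensorMap f g
  invFun := tensorMap f.symm g.symm
  left_inv := tensor_hom_ext (F := (tensorMap f.symm g.symm).comp (tensorMap f g))
    (G := AddMonoidHom.id _) fun x y =>
      congrArg₂ tmul (f.symm_apply x) (g.symm_apply y)
  right_inv := tensor_hom_ext (F := (tensorMap f g).comp (tensorMap f.symm g.symm))
    (G := AddMonoidHom.id _) fun x y =>
      congrArg₂ tmul (f.apply_symm x) (g.apply_symm y)
  map_add' := map_add _
  map_lsmul := tensor_map_lsmul _ fun a x y => by
    rw [tensorMap_tmul, f.map_lsmul]; rfl
  map_rsmul := tensor_map_rsmul _ fun a x y => by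
    rw [tensorMap_tmul, g.map_rsmul]; rfl

section Assoc

variable (X : Bimodule k A B) (Y : Bimodule k B C) (Z : Bimodule k C D)

/-- The additive map underlying `assoc`. -/
noncomputable def assocHom :
    ((X ⊠ Y : Bimodule k A C) ⊠ Z : Bimodule k A D) →+
      (X ⊠ (Y ⊠ Z : Bimodule k B D) : Bimodule k A D) :=
  tensorLift
    (fun w z => tensorLift (P := (X ⊠ (Y ⊠ Z : Bimodule k B D) : Bimodule k A D))
      (fun x y => tmul x (tmul y z))
      (fun x x' y => add_tmul x x' _)
      (fun x y y' => by rw [add_tmul, tmul_add])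
      (fun x b y => by rw [tmul_balanced, lsmul_tmul]) w)
    (fun w w' z => map_add _ w w')
    (fun w z z' => by
      induction w using tensor_induction with
      | h0 => simp
      | ht x y => simp only [tensorLift_tmul]; rw [tmul_add, tmul_add]
      | ha u v hu hv => simp only [map_add, hu, hv]; abel)
    (fun w c z => by
      induction w using tensor_induction with
      | h0 => simp
      | ht x y => rw [rsmul_tmul, tensorLift_tmul, tensorLift_tmul, tmul_balanced]
      | ha u v hu hv => simp only [smul_add, map_add, hu, hv])

theorem assocHom_tmul (x : X) (y : Y) (z : Z) :
    assocHom X Y Z (tmul (tmul x y) z) = tmul x (tmul y z) := rfl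

/-- The additive map underlying the inverse of `assoc`. -/
noncomputable def assocInvHom :
    (X ⊠ (Y ⊠ Z : Bimodule k B D) : Bimodule k A D) →+
      ((X ⊠ Y : Bimodule k A C) ⊠ Z : Bimodule k A D) :=
  tensorLift
    (fun x w => tensorLift (P := ((X ⊠ Y : Bimodule k A C) ⊠ Z : Bimodule k A D))
      (fun y z => tmul (tmul x y) z)
      (fun y y' z => by rw [tmul_add, add_tmul])
      (fun y z z' => tmul_add _ z z')
      (fun y c z => by rw [← tmul_balanced, rsmul_tmul]) w)
    (fun x x' w => by
      induction w using tensor_induction with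
      | h0 => simp
      | ht y z => simp only [tensorLift_tmul]; rw [add_tmul, add_tmul]
      | ha u v hu hv => simp only [map_add, hu, hv]; abel)
    (fun x w w' => map_add _ w w')
    (fun x b w => by
      induction w using tensor_induction with
      | h0 => simp
      | ht y z => rw [lsmul_tmul, tensorLift_tmul, tensorLift_tmul, tmul_balanced]
      | ha u v hu hv => simp only [smul_add, map_add, hu, hv])

theorem assocInvHom_tmul (x : X) (y : Y) (z : Z) :
    assocInvHom X Y Z (tmul x (tmul y z)) = tmul (tmul x y) z := rfl

/-- The associativity isomorphism `(x ⊗ y) ⊗ z ↦ x ⊗ (y ⊗ z)`. -/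
noncomputable def assoc :
    ((X ⊠ Y : Bimodule k A C) ⊠ Z : Bimodule k A D) ≃ᵇ
      (X ⊠ (Y ⊠ Z : Bimodule k B D) : Bimodule k A D) where
  toFun := assocHom X Y Z
  invFun := assocInvHom X Y Z
  left_inv := tensor_hom_ext (F := (assocInvHom X Y Z).comp (assocHom X Y Z))
    (G := AddMonoidHom.id _) fun w z => by
      induction w using tensor_induction with
      | h0 => simp [zero_tmul]
      | ht x y => rfl
      | ha u v hu hv => rw [add_tmul, map_add, map_add, hu, hv]
  right_inv := tensor_hom_ext (F := (assocHom X Y Z).comp (assocInvHom X Y Z))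
    (G := AddMonoidHom.id _) fun x w => by
      induction w using tensor_induction with
      | h0 => simp [tmul_zero]
      | ht y z => rfl
      | ha u v hu hv => rw [tmul_add, map_add, map_add, hu, hv]
  map_add' := map_add _
  map_lsmul := tensor_map_lsmul _ fun a w z => by
    induction w using tensor_induction with
    | h0 => simp [zero_tmul]
    | ht x y => rfl
    | ha u v hu hv => rw [smul_add, add_tmul, add_tmul, map_add, map_add, hu, hv, smul_add]
  map_rsmul := tensor_map_rsmul _ fun a w z => by
    induction w using tensor_induction with
    | h0 => simp [zero_tmul]
    | ht x y => rfl
    | ha u v hu hv => rw [add_tmul, add_tmul, map_add, map_add, hu, hv, smul_add]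

end Assoc

end

end Bimodule

/-! # Finite graphs and Leavitt path algebras -/

/-- A finite directed graph, with vertex set `V`, edge set `E`, and source and range maps. -/
structure FinGraph where
  V : Type u
  E : Type u
  [fintypeV : Fintype V]
  [fintypeE : Fintype E]
  [decEqV : DecidableEq V]
  [decEqE : DecidableEq E]
  src : E → V
  rng : E → V

namespace FinGraph

attribute [instance] fintypeV fintypeE decEqV decEqE

/-- Every vertex is the source of some edge. -/
def NoSinks (G : FinGraph.{u}) : Prop := ∀ v : G.V, ∃ e : G.E, G.src e = v

/-- The edges from `v` to `w` as morphisms, which makes `Quiver.Path v w` the type of finite directed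
paths from `v` to `w` (including the path of length `0` at each vertex). -/
instance (G : FinGraph.{u}) : Quiver.{u} G.V :=
  ⟨fun v w => {e : G.E // G.src e = v ∧ G.rng e = w}⟩

/-- The algebra `kG⁰`: functions on the vertex set with pointwise operations. The vertex `v` is
`Pi.single v 1`. -/
abbrev VAlg (k : Type u) [Field k] (G : FinGraph.{u}) : Type u := G.V → k

variable (k : Type u) [Field k] (G : FinGraph.{u})

/-- The vertex `v` as an element of `kG⁰`. -/
def vert (v : G.V) : VAlg k G := Pi.single v 1

/-- The vector space `kG¹` on the edges, with the `kG⁰`-`kG⁰`-bimodule structure in which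
`v · e` is `e` if `v` is the source of `e` and `0` otherwise, and `e · w` is `e` if `w` is the range
of `e` and `0` otherwise. -/
def edgeBim : Bimodule k (VAlg k G) (VAlg k G) :=
  letI : Module (VAlg k G) (G.E → k) :=
    { smul := fun a x e => a (G.src e) * x e
      one_smul := fun x => funext fun e => one_mul (x e)
      mul_smul := fun a b x => funext fun e => mul_assoc (a (G.src e)) (b (G.src e)) (x e)
      smul_zero := fun a => funext fun e => mul_zero (a (G.src e))
      smul_add := fun a x y => funext fun e => mul_add (a (G.src e)) (x e) (y e)
      add_smul := fun a b x => funext fun e => add_mul (a (G.src e)) (b (G.src e)) (x e)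
      zero_smul := fun x => funext fun e => zero_mul (x e) }
  letI : Module (VAlg k G)ᵐᵒᵖ (G.E → k) :=
    { smul := fun a x e => x e * a.unop (G.rng e)
      one_smul := fun x => funext fun e => mul_one (x e)
      mul_smul := fun a b x => funext fun e =>
        (mul_assoc (x e) (b.unop (G.rng e)) (a.unop (G.rng e))).symm
      smul_zero := fun a => funext fun e => zero_mul (a.unop (G.rng e))
      smul_add := fun a x y => funext fun e => add_mul (x e) (y e) (a.unop (G.rng e))
      add_smul := fun a b x => funext fun e => mul_add (x e) (a.unop (G.rng e)) (b.unop (G.rng e))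
      zero_smul := fun x => funext fun e => mul_zero (x e) }
  { carrier := G.E → k
    smulComm := ⟨fun a b x => funext fun e =>
      (mul_assoc (a (G.src e)) (x e) (b.unop (G.rng e))).symm⟩
    central := fun c x => funext fun e => mul_comm c (x e) }

variable {k G}

/-- The coefficient of an element of `kG¹` at an edge. -/
def coeff (x : edgeBim k G) (e : G.E) : k := (show G.E → k from x) e

variable (k) in
/-- The edge `e` as an element of `kG¹`. -/
def edge (e : G.E) : edgeBim k G := (Pi.single e 1 : G.E → k)

theorem edge_ext {x y : edgeBim k G} (h : ∀ e, coeff x e = coeff y e) : x = y := funext h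

theorem coeff_add (x y : edgeBim k G) (e : G.E) : coeff (x + y) e = coeff x e + coeff y e := rfl

theorem coeff_zero (e : G.E) : coeff (0 : edgeBim k G) e = 0 := rfl

theorem coeff_lsmul (a : VAlg k G) (x : edgeBim k G) (e : G.E) :
    coeff (a • x) e = a (G.src e) * coeff x e := rfl

theorem coeff_rsmul (a : (VAlg k G)ᵐᵒᵖ) (x : edgeBim k G) (e : G.E) :
    coeff (a • x) e = coeff x e * a.unop (G.rng e) := rfl

theorem coeff_edge (e f : G.E) : coeff (edge k e) f = if f = e then 1 else 0 :=
  Pi.single_apply e (1 : k) f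

theorem coeff_sum {ι : Type*} (s : Finset ι) (g : ι → edgeBim k G) (e : G.E) :
    coeff (∑ i ∈ s, g i) e = ∑ i ∈ s, coeff (g i) e :=
  map_sum (AddMonoidHom.mk' (fun x : edgeBim k G => coeff x e) fun x y => coeff_add x y e) g s

theorem edge_expand (x : edgeBim k G) :
    x = ∑ e, op (Pi.single (G.rng e) (coeff x e) : VAlg k G) • edge k e := by
  refine edge_ext fun f => ?_
  rw [coeff_sum, Finset.sum_eq_single f]
  · simp [coeff_rsmul, coeff_edge]
  · intro e _ he
    simp [coeff_rsmul, coeff_edge, he.symm]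
  · simp

theorem vert_src_smul_edge (e : G.E) : vert k G (G.src e) • edge k e = edge k e := by
  refine edge_ext fun f => ?_
  rw [coeff_lsmul, coeff_edge]
  split_ifs with h
  · simp [vert, h]
  · simp

theorem edge_smul_vert_rng (e : G.E) : op (vert k G (G.rng e)) • edge k e = edge k e := by
  refine edge_ext fun f => ?_
  rw [coeff_rsmul, coeff_edge]
  split_ifs with h
  · simp [vert, h]
  · simp

variable (k G)

/-- Generators of the Leavitt path algebra: vertices `v`, edges `e`, ghost edges `e*`. -/
inductive Gen : Type u
  | vertex : G.V → Gen
  | edge : G.E → Gen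
  | ghost : G.E → Gen

/-- The free associative unital algebra on the generators. -/
abbrev FreeGen : Type u := FreeAlgebra k G.Gen

/-- The defining relations of the Leavitt path algebra, together with `∑ v = 1`. -/
inductive LeavittRel : FreeGen k G → FreeGen k G → Prop
  | unit : LeavittRel (∑ v : G.V, FreeAlgebra.ι k (Gen.vertex v)) 1
  | vertex (v w : G.V) : LeavittRel
      (FreeAlgebra.ι k (Gen.vertex v) * FreeAlgebra.ι k (Gen.vertex w))
      (if v = w then FreeAlgebra.ι k (Gen.vertex v) else 0)
  | src_edge (e : G.E) : LeavittRel
      (FreeAlgebra.ι k (Gen.vertex (G.src e)) * FreeAlgebra.ι k (Gen.edge e))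
      (FreeAlgebra.ι k (Gen.edge e))
  | edge_rng (e : G.E) : LeavittRel
      (FreeAlgebra.ι k (Gen.edge e) * FreeAlgebra.ι k (Gen.vertex (G.rng e)))
      (FreeAlgebra.ι k (Gen.edge e))
  | rng_ghost (e : G.E) : LeavittRel
      (FreeAlgebra.ι k (Gen.vertex (G.rng e)) * FreeAlgebra.ι k (Gen.ghost e))
      (FreeAlgebra.ι k (Gen.ghost e))
  | ghost_src (e : G.E) : LeavittRel
      (FreeAlgebra.ι k (Gen.ghost e) * FreeAlgebra.ι k (Gen.vertex (G.src e)))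
      (FreeAlgebra.ι k (Gen.ghost e))
  | ck1 (e f : G.E) : LeavittRel
      (FreeAlgebra.ι k (Gen.ghost e) * FreeAlgebra.ι k (Gen.edge f))
      (if e = f then FreeAlgebra.ι k (Gen.vertex (G.rng e)) else 0)
  | ck2 (v : G.V) (hv : ∃ e, G.src e = v) : LeavittRel
      (FreeAlgebra.ι k (Gen.vertex v))
      (∑ e : G.E with G.src e = v,
        FreeAlgebra.ι k (Gen.edge e) * FreeAlgebra.ι k (Gen.ghost e))

/-- The Leavitt path algebra `L_k(G)` of the finite graph `G`. -/
def Leavitt : Type u := RingQuot (LeavittRel k G)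

namespace Leavitt

noncomputable instance : Ring (Leavitt k G) := inferInstanceAs (Ring (RingQuot (LeavittRel k G)))

noncomputable instance : Algebra k (Leavitt k G) :=
  inferInstanceAs (Algebra k (RingQuot (LeavittRel k G)))

/-- The quotient map from the free algebra. -/
noncomputable def mk : FreeGen k G →ₐ[k] Leavitt k G := RingQuot.mkAlgHom k (LeavittRel k G)

variable {G}

/-- The vertex `v` in `L_k(G)`. -/
noncomputable def v (v : G.V) : Leavitt k G := mk k G (FreeAlgebra.ι k (Gen.vertex v))

/-- The edge `e` in `L_k(G)`. -/
noncomputable def e (e : G.E) : Leavitt k G := mk k G (FreeAlgebra.ι k (Gen.edge e))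

/-- The ghost edge `e*` in `L_k(G)`. -/
noncomputable def eStar (e : G.E) : Leavitt k G := mk k G (FreeAlgebra.ι k (Gen.ghost e))

variable {k}

theorem mk_rel {x y : FreeGen k G} (h : LeavittRel k G x y) : mk k G x = mk k G y :=
  RingQuot.mkAlgHom_rel k h

variable (k)

theorem sum_v : ∑ w : G.V, v k w = 1 := by
  simpa [v] using mk_rel (LeavittRel.unit (k := k) (G := G))

theorem v_mul_v (w w' : G.V) : v k w * v k w' = if w = w' then v k w else 0 := by
  have h := mk_rel (LeavittRel.vertex (k := k) w w')
  rw [map_mul] at h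
  refine h.trans ?_
  split_ifs
  · rfl
  · exact map_zero _

theorem v_mul_e (f : G.E) : v k (G.src f) * e k f = e k f := by
  simpa [v, e] using mk_rel (LeavittRel.src_edge (k := k) f)

theorem e_mul_v (f : G.E) : e k f * v k (G.rng f) = e k f := by
  simpa [v, e] using mk_rel (LeavittRel.edge_rng (k := k) f)

theorem v_mul_eStar (f : G.E) : v k (G.rng f) * eStar k f = eStar k f := by
  simpa [v, eStar] using mk_rel (LeavittRel.rng_ghost (k := k) f)

theorem eStar_mul_v (f : G.E) : eStar k f * v k (G.src f) = eStar k f := by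
  simpa [v, eStar] using mk_rel (LeavittRel.ghost_src (k := k) f)

theorem eStar_mul_e (f g : G.E) : eStar k f * e k g = if f = g then v k (G.rng f) else 0 := by
  have h := mk_rel (LeavittRel.ck1 (k := k) f g)
  rw [map_mul] at h
  refine h.trans ?_
  split_ifs
  · rfl
  · exact map_zero _

theorem ck2 (w : G.V) (hw : ∃ f, G.src f = w) :
    v k w = ∑ f : G.E with G.src f = w, e k f * eStar k f := by
  simpa [v, e, eStar] using mk_rel (LeavittRel.ck2 (k := k) w hw)

theorem sum_e_mul_eStar (hG : G.NoSinks) : ∑ f : G.E, e k f * eStar k f = 1 := by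
  rw [← sum_v, ← Finset.sum_fiberwise (s := Finset.univ) (g := G.src)]
  exact Finset.sum_congr rfl fun w _ => (ck2 k w (hG w)).symm

/-- The product in `L_k(G)` of the edges of a path (the vertex itself for a path of length `0`). -/
noncomputable def path {a : G.V} : {b : G.V} → Quiver.Path a b → Leavitt k G
  | _, .nil => v k a
  | _, .cons p f => path p * e k f.1

/-- The element `(f₁ ⋯ fₙ)* = fₙ* ⋯ f₁*` of `L_k(G)` for a path `f₁ ⋯ fₙ`. -/
noncomputable def pathStar {a : G.V} : {b : G.V} → Quiver.Path a b → Leavitt k G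
  | _, .nil => v k a
  | _, .cons p f => eStar k f.1 * pathStar p

variable (G) in
/-- The standard `ℤ`-grading on `L_k(G)`: the component of degree `n` is spanned over `k` by the
elements `αβ*` with `α` and `β` paths with the same range and `length α - length β = n`. -/
noncomputable def grading (n : ℤ) : AddSubgroup (Leavitt k G) :=
  (Submodule.span k {x : Leavitt k G | ∃ (a b c : G.V) (α : Quiver.Path a c) (β : Quiver.Path b c),
    (α.length : ℤ) - β.length = n ∧ x = path k α * pathStar k β}).toAddSubgroup

/-- The inclusion `kG⁰ → L_k(G)`. -/
noncomputable def ofVAlg : VAlg k G →ₐ[k] Leavitt k G where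
  toFun a := ∑ w, a w • v k w
  map_one' := by simp [sum_v]
  map_mul' a b := by
    simp only [Finset.sum_mul, Finset.mul_sum, smul_mul_assoc, mul_smul_comm, v_mul_v, Pi.mul_apply,
      smul_ite, smul_zero, Finset.sum_ite_eq', Finset.mem_univ, if_true]
    exact Finset.sum_congr rfl fun w _ => by rw [smul_smul, mul_comm]
  map_zero' := by simp
  map_add' a b := by simp [add_smul, Finset.sum_add_distrib]
  commutes' c := by
    simp only [Pi.algebraMap_apply, Algebra.algebraMap_self, RingHom.id_apply]
    rw [← Finset.smul_sum, sum_v, Algebra.algebraMap_eq_smul_one]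

theorem ofVAlg_single (w : G.V) (c : k) : ofVAlg k (Pi.single w c) = c • v k w := by
  change ∑ u, (Pi.single w c : G.V → k) u • v k u = _
  rw [Finset.sum_eq_single w]
  · simp
  · intro u _ hu
    simp [hu]
  · simp

theorem ofVAlg_vert (w : G.V) : ofVAlg k (vert k G w) = v k w := by
  rw [vert, ofVAlg_single, one_smul]

theorem eStar_mul_ofVAlg (f : G.E) (a : VAlg k G) :
    eStar k f * ofVAlg k a = a (G.src f) • eStar k f := by
  change eStar k f * ∑ u, a u • v k u = _
  rw [Finset.mul_sum, Finset.sum_eq_single (G.src f)]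
  · rw [mul_smul_comm, eStar_mul_v]
  · intro u _ hu
    rw [mul_smul_comm, ← eStar_mul_v, mul_assoc, v_mul_v, if_neg (Ne.symm hu)]
    simp
  · simp

theorem ofVAlg_mul_e (f : G.E) (a : VAlg k G) :
    ofVAlg k a * e k f = a (G.src f) • e k f := by
  change (∑ u, a u • v k u) * e k f = _
  rw [Finset.sum_mul, Finset.sum_eq_single (G.src f)]
  · rw [smul_mul_assoc, v_mul_e]
  · intro u _ hu
    rw [smul_mul_assoc, ← v_mul_e, ← mul_assoc, v_mul_v, if_neg hu]
    simp
  · simp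

theorem e_mul_ofVAlg (f : G.E) (a : VAlg k G) :
    e k f * ofVAlg k a = a (G.rng f) • e k f := by
  change e k f * ∑ u, a u • v k u = _
  rw [Finset.mul_sum, Finset.sum_eq_single (G.rng f)]
  · rw [mul_smul_comm, e_mul_v]
  · intro u _ hu
    rw [mul_smul_comm, ← e_mul_v, mul_assoc, v_mul_v, if_neg (Ne.symm hu)]
    simp
  · simp

/-- The additive inclusion `kG¹ → L_k(G)`. -/
noncomputable def ofEdge : edgeBim k G →+ Leavitt k G :=
  AddMonoidHom.mk' (fun x => ∑ f, coeff x f • e k f) fun x y => by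
    simp [coeff_add, add_smul, Finset.sum_add_distrib]

theorem ofEdge_apply (x : edgeBim k G) : ofEdge k x = ∑ f, coeff x f • e k f := rfl

theorem ofEdge_edge (f : G.E) : ofEdge k (edge k f) = e k f := by
  rw [ofEdge_apply, Finset.sum_eq_single f]
  · simp [coeff_edge]
  · intro g _ hg
    simp [coeff_edge, hg]
  · simp

theorem ofEdge_lsmul (a : VAlg k G) (x : edgeBim k G) :
    ofEdge k (a • x) = ofVAlg k a * ofEdge k x := by
  rw [ofEdge_apply, ofEdge_apply, Finset.mul_sum]
  refine Finset.sum_congr rfl fun f _ => ?_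
  rw [coeff_lsmul, mul_smul_comm, ofVAlg_mul_e, smul_smul, mul_comm]

theorem ofEdge_rsmul (a : VAlg k G) (x : edgeBim k G) :
    ofEdge k (op a • x) = ofEdge k x * ofVAlg k a := by
  rw [ofEdge_apply, ofEdge_apply, Finset.sum_mul]
  refine Finset.sum_congr rfl fun f _ => ?_
  rw [coeff_rsmul, smul_mul_assoc, e_mul_ofVAlg, smul_smul, unop_op]

variable (G)

/-- `L_k(G)` as a `kG⁰`-`L_k(G)`-bimodule under multiplication. -/
noncomputable def bim : Bimodule k (VAlg k G) (Leavitt k G) :=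
  letI : Module (VAlg k G) (Leavitt k G) := Module.compHom _ (ofVAlg k (G := G)).toRingHom
  { carrier := Leavitt k G
    smulComm := ⟨fun a b x => (mul_assoc (ofVAlg k a) x b.unop).symm⟩
    central := fun c x => by
      change ofVAlg k (algebraMap k (VAlg k G) c) * x = x * algebraMap k (Leavitt k G) c
      rw [AlgHom.commutes, Algebra.commutes] }

end Leavitt

end FinGraph

/-! # The bridging bimodule -/

namespace Bimodule

open FinGraph

section Action

variable {k : Type u} [Field k] {G : FinGraph.{u}} {S : Type u} [Ring S] [Algebra k S]

/-- For an edge `e`, the map `kG¹ ⊗ Y → Y`, `x ⊗ y ↦ (e*x)y`, where `e*x ∈ kG⁰` is the coefficient of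
`x` at `e` times the range of `e`. -/
noncomputable def contract (Y : Bimodule k (VAlg k G) S) (e : G.E) :
    (edgeBim k G ⊠ Y : Bimodule k (VAlg k G) S) →+ Y :=
  tensorLift (fun x y => (Pi.single (G.rng e) (coeff x e) : VAlg k G) • y)
    (fun x x' y => by rw [coeff_add, Pi.single_add, add_smul])
    (fun x y y' => smul_add _ _ _)
    (fun x a y => by
      rw [coeff_rsmul, smul_smul]
      congr 1
      funext w
      rcases eq_or_ne w (G.rng e) with rfl | hw
      · simp
      · simp [hw])

theorem contract_tmul (Y : Bimodule k (VAlg k G) S) (e : G.E) (x : edgeBim k G) (y : Y) :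
    contract Y e (tmul x y) = (Pi.single (G.rng e) (coeff x e) : VAlg k G) • y := rfl

theorem contract_rsmul (Y : Bimodule k (VAlg k G) S) (e : G.E) (s : Sᵐᵒᵖ)
    (z : (edgeBim k G ⊠ Y : Bimodule k (VAlg k G) S)) :
    contract Y e (s • z) = s • contract Y e z := by
  induction z using tensor_induction with
  | h0 => simp
  | ht x y => rw [rsmul_tmul, contract_tmul, contract_tmul, smul_comm]
  | ha z w hz hw => simp only [smul_add, map_add, hz, hw]

theorem tmul_contract (Y : Bimodule k (VAlg k G) S) (v : G.V)
    (z : (edgeBim k G ⊠ Y : Bimodule k (VAlg k G) S)) :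
    ∑ e : G.E with G.src e = v, tmul (edge k e) (contract Y e z) = vert k G v • z := by
  induction z using tensor_induction with
  | h0 => simp [tmul_zero]
  | ht x y =>
    simp only [contract_tmul, ← tmul_balanced]
    rw [← sum_tmul, lsmul_tmul]
    congr 1
    refine edge_ext fun f => ?_
    rw [coeff_sum, coeff_lsmul]
    by_cases hf : G.src f = v
    · rw [Finset.sum_eq_single f]
      · simp [coeff_rsmul, coeff_edge, vert, hf]
      · intro e _ he
        simp [coeff_rsmul, coeff_edge, he.symm]
      · simp [hf]
    · rw [Finset.sum_eq_zero]
      · simp [vert, hf]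
      · intro e he
        have : f ≠ e := by
          rintro rfl
          exact hf (Finset.mem_filter.mp he).2
        simp [coeff_rsmul, coeff_edge, this]
  | ha z w hz hw => simp only [map_add, tmul_add, Finset.sum_add_distrib, hz, hw, smul_add]

variable {Y : Bimodule k (VAlg k G) S}

/-- The central action of `k` on a bimodule. -/
@[reducible] def kModule {A : Type u} [Ring A] [Algebra k A] (Y : Bimodule k A S) : Module k Y :=
  Module.compHom Y (algebraMap k A)

theorem kModule_smulCommClass {A : Type u} [Ring A] [Algebra k A] (Y : Bimodule k A S) :
    letI := kModule Y
    SMulCommClass Sᵐᵒᵖ k Y :=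
  letI := kModule Y
  ⟨fun s c y => (smul_comm (algebraMap k A c) s y).symm⟩

theorem kModule_isScalarTower {A : Type u} [Ring A] [Algebra k A] (Y : Bimodule k A S) :
    letI := kModule Y
    IsScalarTower k Sᵐᵒᵖ Y :=
  letI := kModule Y
  ⟨fun c s y => by
    change (c • s) • y = algebraMap k A c • s • y
    rw [central, smul_smul]
    congr 1
    rw [Algebra.smul_def]
    rfl⟩

/-- The operator by which a vertex acts. -/
def actV (Y : Bimodule k (VAlg k G) S) (v : G.V) : Module.End Sᵐᵒᵖ Y where
  toFun y := vert k G v • y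
  map_add' := smul_add _
  map_smul' s y := smul_comm _ s y

/-- The operator by which an edge acts: `e · y = τ(e ⊗ y)`. -/
noncomputable def actE (τ : (edgeBim k G ⊠ Y : Bimodule k (VAlg k G) S) ≃ᵇ Y) (e : G.E) :
    Module.End Sᵐᵒᵖ Y where
  toFun y := τ (tmul (edge k e) y)
  map_add' y y' := by rw [tmul_add, τ.apply_add]
  map_smul' s y := by rw [← rsmul_tmul, τ.map_rsmul]; rfl

/-- The operator by which a ghost edge acts: if `τ⁻¹(y) = ∑ xᵢ ⊗ yᵢ` then `e* · y = ∑ (e*xᵢ)yᵢ`. -/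
noncomputable def actEStar (τ : (edgeBim k G ⊠ Y : Bimodule k (VAlg k G) S) ≃ᵇ Y) (e : G.E) :
    Module.End Sᵐᵒᵖ Y where
  toFun y := contract Y e (τ.symm y)
  map_add' y y' := by rw [τ.symm.apply_add, map_add]
  map_smul' s y := by rw [τ.symm.map_rsmul, contract_rsmul]; rfl

/-- The action of the generators of the Leavitt path algebra. -/
noncomputable def actGen (τ : (edgeBim k G ⊠ Y : Bimodule k (VAlg k G) S) ≃ᵇ Y) :
    G.Gen → Module.End Sᵐᵒᵖ Y
  | .vertex v => actV Y v
  | .edge e => actE τ e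
  | .ghost e => actEStar τ e

theorem vert_mul_vert (v w : G.V) :
    vert k G v * vert k G w = if v = w then vert k G v else 0 := by
  unfold vert
  split_ifs with h
  · subst h
    simp [← Pi.single_mul]
  · funext u
    rcases eq_or_ne u v with rfl | hu
    · simp [h]
    · simp [hu]

theorem sum_vert : ∑ v, vert k G v = 1 := by
  unfold vert
  exact Finset.univ_sum_single (1 : G.V → k)

theorem actV_apply (v : G.V) (y : Y) : actV Y v y = vert k G v • y := rfl

theorem actE_apply (τ : (edgeBim k G ⊠ Y : Bimodule k (VAlg k G) S) ≃ᵇ Y) (e : G.E) (y : Y) :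
    actE τ e y = τ (tmul (edge k e) y) := rfl

theorem actEStar_apply (τ : (edgeBim k G ⊠ Y : Bimodule k (VAlg k G) S) ≃ᵇ Y) (e : G.E) (y : Y) :
    actEStar τ e y = contract Y e (τ.symm y) := rfl

theorem contract_lsmul (a : VAlg k G) (e : G.E)
    (z : (edgeBim k G ⊠ Y : Bimodule k (VAlg k G) S)) :
    contract Y e (a • z) = (Pi.single (G.rng e) (a (G.src e)) : VAlg k G) • contract Y e z := by
  induction z using tensor_induction with
  | h0 => simp
  | ht x y =>
    rw [lsmul_tmul, contract_tmul, contract_tmul, smul_smul, coeff_lsmul, Pi.single_mul]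
  | ha z w hz hw => simp only [smul_add, map_add, hz, hw]

theorem vert_smul_contract (e : G.E) (z : (edgeBim k G ⊠ Y : Bimodule k (VAlg k G) S)) :
    vert k G (G.rng e) • contract Y e z = contract Y e z := by
  induction z using tensor_induction with
  | h0 => simp
  | ht x y => rw [contract_tmul, smul_smul, vert, ← Pi.single_mul, one_mul]
  | ha z w hz hw => simp only [smul_add, map_add, hz, hw]

/-- The action of the free algebra on the generators. -/
noncomputable def actFree (τ : (edgeBim k G ⊠ Y : Bimodule k (VAlg k G) S) ≃ᵇ Y) :
    letI := kModule Y
    letI := kModule_smulCommClass Y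
    letI := kModule_isScalarTower Y
    FreeGen k G →ₐ[k] Module.End Sᵐᵒᵖ Y :=
  letI := kModule Y
  letI := kModule_smulCommClass Y
  letI := kModule_isScalarTower Y
  FreeAlgebra.lift k (actGen τ)

theorem actFree_rel (τ : (edgeBim k G ⊠ Y : Bimodule k (VAlg k G) S) ≃ᵇ Y) {a b : FreeGen k G}
    (h : LeavittRel k G a b) : actFree τ a = actFree τ b := by
  let _ := kModule Y
  have _ := kModule_smulCommClass Y
  have _ := kModule_isScalarTower Y
  have hι : ∀ x, actFree τ (FreeAlgebra.ι k x) = actGen τ x := fun x =>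
    FreeAlgebra.lift_ι_apply (actGen τ) x
  refine LinearMap.ext fun y => ?_
  cases h with
  | unit =>
    rw [map_sum, map_one]
    simp only [hι, actGen, LinearMap.sum_apply, actV_apply]
    rw [← Finset.sum_smul, sum_vert, one_smul]
    rfl
  | vertex v w =>
    rw [map_mul, hι, hι, apply_ite (actFree τ), hι, map_zero]
    change vert k G v • vert k G w • y = _
    rw [smul_smul, vert_mul_vert]
    split_ifs
    · rfl
    · exact zero_smul _ y
  | src_edge e =>
    rw [map_mul, hι, hι]
    change vert k G (G.src e) • τ (tmul (edge k e) y) = τ (tmul (edge k e) y)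
    rw [← vert_src_smul_edge e, ← lsmul_tmul, τ.map_lsmul]
    change vert k G (G.src e) • vert k G (G.src e) • τ (tmul (edge k e) y) = _
    rw [smul_smul, vert_mul_vert, if_pos rfl]
  | edge_rng e =>
    rw [map_mul, hι, hι]
    change τ (tmul (edge k e) (vert k G (G.rng e) • y)) = τ (tmul (edge k e) y)
    rw [← tmul_balanced, edge_smul_vert_rng]
  | rng_ghost e =>
    rw [map_mul, hι, hι]
    exact vert_smul_contract e _
  | ghost_src e =>
    rw [map_mul, hι, hι]
    change contract Y e (τ.symm (vert k G (G.src e) • y)) = contract Y e (τ.symm y)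
    rw [τ.symm.map_lsmul, contract_lsmul]
    refine Eq.trans ?_ (vert_smul_contract e (τ.symm y))
    simp [vert]
  | ck1 e f =>
    rw [map_mul, hι, hι, apply_ite (actFree τ), hι, map_zero]
    change contract Y e (τ.symm (τ (tmul (edge k f) y))) = _
    rw [τ.symm_apply, contract_tmul, coeff_edge]
    split_ifs
    · rfl
    · rw [Pi.single_zero, zero_smul]
      rfl
  | ck2 v hv =>
    rw [map_sum, hι]
    simp only [map_mul, hι, LinearMap.sum_apply]
    change vert k G v • y =
      ∑ e : G.E with G.src e = v, τ (tmul (edge k e) (contract Y e (τ.symm y)))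
    rw [← τ.apply_sum, tmul_contract, τ.map_lsmul]
    change _ = vert k G v • τ (τ.symm y)
    rw [τ.apply_symm]

/-- The action of `L_k(G)`, as a ring homomorphism to the ring of right `S`-linear endomorphisms. -/
noncomputable def act (τ : (edgeBim k G ⊠ Y : Bimodule k (VAlg k G) S) ≃ᵇ Y) :
    letI := kModule Y
    letI := kModule_smulCommClass Y
    letI := kModule_isScalarTower Y
    Leavitt k G →ₐ[k] Module.End Sᵐᵒᵖ Y :=
  letI := kModule Y
  letI := kModule_smulCommClass Y
  letI := kModule_isScalarTower Y
  RingQuot.liftAlgHom k ⟨actFree τ, fun _ _ h => actFree_rel τ h⟩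

/-- Given a `kG⁰`-`S`-bimodule `Y` and a bimodule isomorphism `τ : kG¹ ⊗ Y → Y`, the
`L_k(G)`-`S`-bimodule structure on `Y` in which vertices act as before, `e · y = τ(e ⊗ y)`, and
`e* · y = ∑ (e*xᵢ)yᵢ` when `τ⁻¹(y) = ∑ xᵢ ⊗ yᵢ`. -/
noncomputable def leavittExtend (Y : Bimodule k (VAlg k G) S)
    (τ : (edgeBim k G ⊠ Y : Bimodule k (VAlg k G) S) ≃ᵇ Y) : Bimodule k (Leavitt k G) S :=
  letI := kModule Y
  letI := kModule_smulCommClass Y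
  letI := kModule_isScalarTower Y
  letI : Module (Leavitt k G) Y := Module.compHom Y (act τ).toRingHom
  { carrier := Y
    smulComm := ⟨fun a s y => (act τ a).map_smul s y⟩
    central := fun c y => by
      change act τ (algebraMap k (Leavitt k G) c) y = _
      rw [AlgHom.commutes, ← Y.central]
      rfl }

end Action

section Bridging

variable (k : Type u) [Field k] {E F G : FinGraph.{u}}

/-- Multiplication `kG¹ ⊗ L_k(G) → L_k(G)`. -/
noncomputable def rhoHom (G : FinGraph.{u}) :
    (edgeBim k G ⊠ Leavitt.bim k G : Bimodule k (VAlg k G) (Leavitt k G)) →+ Leavitt.bim k G :=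
  tensorLift (P := Leavitt.bim k G) (fun x (y : Leavitt k G) => (Leavitt.ofEdge k x * y : Leavitt k G))
    (fun x x' y => (congrArg (fun t => t * (show Leavitt k G from y))
      (map_add (Leavitt.ofEdge k) x x')).trans
        (add_mul (Leavitt.ofEdge k x) (Leavitt.ofEdge k x') (show Leavitt k G from y)))
    (fun x y y' => mul_add (Leavitt.ofEdge k x) (show Leavitt k G from y) (show Leavitt k G from y'))
    (fun x a y => by
      rw [Leavitt.ofEdge_rsmul]
      exact mul_assoc (Leavitt.ofEdge k x) (Leavitt.ofVAlg k a) (show Leavitt k G from y))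

theorem rhoHom_tmul (x : edgeBim k G) (y : Leavitt k G) :
    rhoHom k G (tmul x (show Leavitt.bim k G from y)) = (Leavitt.ofEdge k x * y : Leavitt k G) := rfl

/-- The inverse of multiplication, `y ↦ ∑ f ⊗ f*y`. -/
noncomputable def rhoInv (G : FinGraph.{u}) (y : Leavitt k G) :
    (edgeBim k G ⊠ Leavitt.bim k G : Bimodule k (VAlg k G) (Leavitt k G)) :=
  ∑ f : G.E, tmul (edge k f) (show Leavitt.bim k G from (Leavitt.eStar k f * y : Leavitt k G))

theorem rhoInv_mul (x : edgeBim k G) (y : Leavitt k G) :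
    rhoInv k G (Leavitt.ofEdge k x * y) = tmul x (show Leavitt.bim k G from y) := by
  unfold rhoInv
  conv_rhs => rw [edge_expand x]
  rw [sum_tmul]
  refine Finset.sum_congr rfl fun f _ => ?_
  rw [tmul_balanced]
  congr 1
  change Leavitt.eStar k f * (Leavitt.ofEdge k x * y) = Leavitt.ofVAlg k (Pi.single _ _) * y
  rw [Leavitt.ofVAlg_single, Leavitt.ofEdge_apply, ← mul_assoc, Finset.mul_sum,
    Finset.sum_eq_single f]
  · rw [mul_smul_comm, Leavitt.eStar_mul_e, if_pos rfl]
  · intro g _ hg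
    rw [mul_smul_comm, Leavitt.eStar_mul_e, if_neg hg.symm, smul_zero]
  · simp

/-- The isomorphism `kG¹ ⊗ L_k(G) ≅ L_k(G)`, `x ⊗ y ↦ xy`, for a finite graph without sinks. -/
noncomputable def rho (hG : G.NoSinks) :
    (edgeBim k G ⊠ Leavitt.bim k G : Bimodule k (VAlg k G) (Leavitt k G)) ≃ᵇ Leavitt.bim k G where
  toFun := rhoHom k G
  invFun := rhoInv k G
  left_inv z := by
    have hadd : ∀ y y' : Leavitt k G, rhoInv k G (y + y') = rhoInv k G y + rhoInv k G y' := by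
      intro y y'
      unfold rhoInv
      rw [← Finset.sum_add_distrib]
      refine Finset.sum_congr rfl fun f _ => ?_
      rw [mul_add]
      exact tmul_add _ _ _
    refine tensor_hom_ext (F := (AddMonoidHom.mk' (rhoInv k G) hadd).comp (rhoHom k G))
      (G := AddMonoidHom.id _) (fun x y => ?_) z
    exact rhoInv_mul k x y
  right_inv y := by
    unfold rhoInv
    rw [map_sum]
    simp only [rhoHom_tmul, Leavitt.ofEdge_edge]
    have h : ∀ y : Leavitt k G, ∑ f : G.E, Leavitt.e k f * (Leavitt.eStar k f * y) = y := by
      intro y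
      simp only [← mul_assoc]
      rw [← Finset.sum_mul, Leavitt.sum_e_mul_eStar k hG, one_mul]
    exact h y
  map_add' := map_add _
  map_lsmul := tensor_map_lsmul _ fun a x y => by
    change Leavitt.ofEdge k (a • x) * (show Leavitt k G from y) =
      Leavitt.ofVAlg k a * (Leavitt.ofEdge k x * (show Leavitt k G from y))
    rw [Leavitt.ofEdge_lsmul, mul_assoc]
  map_rsmul := tensor_map_rsmul _ fun s x y => by
    exact (mul_assoc (Leavitt.ofEdge k x) (show Leavitt k G from y) s.unop).symm

variable {k}

/-- For a bimodule isomorphism `σ : kE¹ ⊗ M → M ⊗ kF¹`, the composite isomorphism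
`kE¹ ⊗ (M ⊗ L_k(F)) ≅ (kE¹ ⊗ M) ⊗ L_k(F) ≅ (M ⊗ kF¹) ⊗ L_k(F) ≅ M ⊗ (kF¹ ⊗ L_k(F)) ≅ M ⊗ L_k(F)`. -/
noncomputable def bridgeIso (hF : F.NoSinks) (M : Bimodule k (VAlg k E) (VAlg k F))
    (σ : edgeBim k E ⊠ M ≃ᵇ M ⊠ edgeBim k F) :
    edgeBim k E ⊠ (M ⊠ Leavitt.bim k F) ≃ᵇ M ⊠ Leavitt.bim k F :=
  (assoc (edgeBim k E) M (Leavitt.bim k F)).symm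
    |>.trans (tensorCongr σ (Equiv.refl _))
    |>.trans (assoc M (edgeBim k F) (Leavitt.bim k F))
    |>.trans (tensorCongr (Equiv.refl M) (rho k hF))

/-- The bridging bimodule `Y_{(M,σ)}`: the `L_k(E)`-`L_k(F)`-bimodule `M ⊗ L_k(F)` with
`v · (m ⊗ S) = vm ⊗ S`, with `e · (m ⊗ S) = ∑ mᵢ ⊗ yᵢS` when `σ(e ⊗ m) = ∑ mᵢ ⊗ yᵢ`, and with
`e* · (m ⊗ S) = ∑_f ∑ᵢ (e*xᵢ)mᵢ ⊗ f*S` when `σ⁻¹(m ⊗ f) = ∑ᵢ xᵢ ⊗ mᵢ` for each edge `f`. -/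
noncomputable def bridging (hF : F.NoSinks) (M : Bimodule k (VAlg k E) (VAlg k F))
    (σ : edgeBim k E ⊠ M ≃ᵇ M ⊠ edgeBim k F) : Bimodule k (Leavitt k E) (Leavitt k F) :=
  leavittExtend (M ⊠ Leavitt.bim k F) (bridgeIso hF M σ)

/-- The isomorphism `σ # ψ : kE¹ ⊗ (M ⊗ N) → (M ⊗ N) ⊗ kG¹` composed from
`σ : kE¹ ⊗ M → M ⊗ kF¹` and `ψ : kF¹ ⊗ N → N ⊗ kG¹`. -/
noncomputable def hashIso {M : Bimodule k (VAlg k E) (VAlg k F)} {N : Bimodule k (VAlg k F) (VAlg k G)}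
    (σ : edgeBim k E ⊠ M ≃ᵇ M ⊠ edgeBim k F) (ψ : edgeBim k F ⊠ N ≃ᵇ N ⊠ edgeBim k G) :
    edgeBim k E ⊠ (M ⊠ N) ≃ᵇ (M ⊠ N) ⊠ edgeBim k G :=
  (assoc (edgeBim k E) M N).symm
    |>.trans (tensorCongr σ (Equiv.refl N))
    |>.trans (assoc M (edgeBim k F) N)
    |>.trans (tensorCongr (Equiv.refl M) ψ)
    |>.trans (assoc M N (edgeBim k G)).symm

variable (k)

/-- `edgePowSucc k G m` is the tensor power `(kG¹)^{⊗(m+1)}` over `kG⁰`, bracketed to the left. -/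
noncomputable def edgePowSucc (G : FinGraph.{u}) : ℕ → Bimodule k (VAlg k G) (VAlg k G)
  | 0 => edgeBim k G
  | m + 1 => edgePowSucc G m ⊠ edgeBim k G

/-- `nuSucc k G m : kG¹ ⊗ (kG¹)^{⊗(m+1)} → (kG¹)^{⊗(m+1)} ⊗ kG¹`. -/
noncomputable def nuSucc (G : FinGraph.{u}) : (m : ℕ) →
    (edgeBim k G ⊠ edgePowSucc k G m ≃ᵇ edgePowSucc k G m ⊠ edgeBim k G)
  | 0 => Equiv.refl _
  | m + 1 => (assoc (edgeBim k G) (edgePowSucc k G m) (edgeBim k G)).symm.trans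
      (tensorCongr (nuSucc G m) (Equiv.refl (edgeBim k G)))

/-- The tensor power `(kG¹)^{⊗n}` over `kG⁰`, for a positive integer `n`. -/
noncomputable def edgePow (G : FinGraph.{u}) (n : ℕ+) : Bimodule k (VAlg k G) (VAlg k G) :=
  edgePowSucc k G n.natPred

/-- The isomorphism `x₁ ⊗ (y₁ ⊗ ⋯ ⊗ yₙ) ↦ (x₁ ⊗ y₁ ⊗ ⋯ ⊗ yₙ₋₁) ⊗ yₙ`. -/
noncomputable def nu (G : FinGraph.{u}) (n : ℕ+) :
    edgeBim k G ⊠ edgePow k G n ≃ᵇ edgePow k G n ⊠ edgeBim k G :=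
  nuSucc k G n.natPred

end Bridging

section TensorFunctor

variable {k R S : Type u} [CommRing k] [Ring R] [Ring S] [Algebra k R] [Algebra k S]

/-- The right `S`-module `X ⊗_R Y`. -/
noncomputable def tensorObj (Y : Bimodule k R S) (X : ModuleCat.{u} Rᵐᵒᵖ) : ModuleCat.{u} Sᵐᵒᵖ :=
  letI : Module Sᵐᵒᵖ (RTensor R X Y) := RTensor.rightModule R S
  ModuleCat.of Sᵐᵒᵖ (RTensor R X Y)

/-- The homomorphism `f ⊗ id`. -/
noncomputable def tensorObjMap (Y : Bimodule k R S) {X X' : ModuleCat.{u} Rᵐᵒᵖ} (f : X ⟶ X') :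
    tensorObj Y X ⟶ tensorObj Y X' :=
  letI : Module Sᵐᵒᵖ (RTensor R X Y) := RTensor.rightModule R S
  letI : Module Sᵐᵒᵖ (RTensor R X' Y) := RTensor.rightModule R S
  ModuleCat.ofHom
    { toFun := RTensor.map R f.hom LinearMap.id
      map_add' := map_add (RTensor.map R f.hom LinearMap.id)
      map_smul' := fun s z => by
        induction z using RTensor.induction with
        | h0 => simp
        | ht x y => rfl
        | ha z w hz hw => rw [smul_add, map_add, hz, hw, map_add, smul_add] }

/-- The functor `X ↦ X ⊗_R Y` from right `R`-modules to right `S`-modules. -/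
noncomputable def tensorFunctor (Y : Bimodule k R S) :
    ModuleCat.{u} Rᵐᵒᵖ ⥤ ModuleCat.{u} Sᵐᵒᵖ where
  obj X := tensorObj Y X
  map f := tensorObjMap Y f
  map_id X := by
    apply ModuleCat.hom_ext
    apply LinearMap.ext
    exact fun z => RTensor.map_id R z
  map_comp f g := by
    apply ModuleCat.hom_ext
    apply LinearMap.ext
    exact fun z => RTensor.map_comp R f.hom g.hom LinearMap.id LinearMap.id z

end TensorFunctor

end Bimodule

/-! # Graded modules and graded Morita equivalence -/

/-- A `ℤ`-graded right module over a ring `R` with grading `𝒜`. -/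
structure GrMod {R : Type u} [Ring R] (𝒜 : ℤ → AddSubgroup R) where
  toMod : ModuleCat.{u} Rᵐᵒᵖ
  gr : ℤ → AddSubgroup toMod
  isInternal : DirectSum.IsInternal gr
  smul_mem : ∀ {i j : ℤ} {m : toMod} {r : R}, m ∈ gr i → r ∈ 𝒜 j → op r • m ∈ gr (i + j)

namespace GrMod

variable {R S : Type u} [Ring R] [Ring S] {𝒜 : ℤ → AddSubgroup R} {ℬ : ℤ → AddSubgroup S}

/-- Morphisms are the module homomorphisms that preserve degrees. -/
instance : Category (GrMod 𝒜) where
  Hom M N := {f : M.toMod ⟶ N.toMod // ∀ (i : ℤ) (m : M.toMod), m ∈ M.gr i → f.hom m ∈ N.gr i}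
  id M := ⟨𝟙 M.toMod, fun _ _ h => h⟩
  comp f g := ⟨f.1 ≫ g.1, fun i m h => g.2 i _ (f.2 i m h)⟩

/-- The forgetful functor to right `R`-modules. -/
def forgetGrading (𝒜 : ℤ → AddSubgroup R) : GrMod 𝒜 ⥤ ModuleCat.{u} Rᵐᵒᵖ where
  obj M := M.toMod
  map f := f.1

theorem isInternal_shift {M : Type u} [AddCommGroup M] {A : ℤ → AddSubgroup M}
    (h : DirectSum.IsInternal A) (γ : ℤ) : DirectSum.IsInternal fun i => A (γ + i) := by
  have h' : DirectSum.IsInternal fun i => AddSubgroup.toIntSubmodule (A i) := h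
  have h'' : DirectSum.IsInternal fun i => AddSubgroup.toIntSubmodule (A (γ + i)) := by
    rw [DirectSum.isInternal_submodule_iff_iSupIndep_and_iSup_eq_top] at h' ⊢
    exact ⟨h'.1.comp (add_right_injective γ),
      ((Equiv.addLeft γ).iSup_comp (g := fun i => AddSubgroup.toIntSubmodule (A i))).trans h'.2⟩
  exact h''

/-- The suspension functor `M ↦ M(γ)`, where `M(γ)_i = M_{γ+i}`. -/
def suspension (𝒜 : ℤ → AddSubgroup R) (γ : ℤ) : GrMod 𝒜 ⥤ GrMod 𝒜 where
  obj M :=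
    { toMod := M.toMod
      gr := fun i => M.gr (γ + i)
      isInternal := isInternal_shift M.isInternal γ
      smul_mem := fun {i j} _ _ hm hr => by
        rw [← add_assoc]
        exact M.smul_mem hm hr }
  map f := ⟨f.1, fun i m h => f.2 (γ + i) m h⟩

/-- A functor between categories of graded modules is graded if it commutes with all suspensions. -/
def IsGradedGr (Φ : GrMod 𝒜 ⥤ GrMod ℬ) : Prop :=
  ∀ γ : ℤ, Φ ⋙ suspension ℬ γ = suspension 𝒜 γ ⋙ Φ

/-- A graded equivalence between categories of graded modules: a graded functor with a graded
quasi-inverse. -/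
def IsGradedEquivGr (Φ : GrMod 𝒜 ⥤ GrMod ℬ) : Prop :=
  IsGradedGr Φ ∧ ∃ Γ : GrMod ℬ ⥤ GrMod 𝒜, IsGradedGr Γ ∧
    Nonempty (Φ ⋙ Γ ≅ 𝟭 (GrMod 𝒜)) ∧ Nonempty (Γ ⋙ Φ ≅ 𝟭 (GrMod ℬ))

/-- A functor between categories of (ungraded) modules is graded if it is induced by a graded functor
between the categories of graded modules. -/
def IsGradedMod (𝒜 : ℤ → AddSubgroup R) (ℬ : ℤ → AddSubgroup S)
    (φ : ModuleCat.{u} Rᵐᵒᵖ ⥤ ModuleCat.{u} Sᵐᵒᵖ) : Prop :=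
  ∃ Φ : GrMod 𝒜 ⥤ GrMod ℬ, IsGradedGr Φ ∧ Φ ⋙ forgetGrading ℬ = forgetGrading 𝒜 ⋙ φ

/-- A graded equivalence between categories of (ungraded) modules: a graded functor that is an
equivalence of categories. -/
def IsGradedEquivMod (𝒜 : ℤ → AddSubgroup R) (ℬ : ℤ → AddSubgroup S)
    (φ : ModuleCat.{u} Rᵐᵒᵖ ⥤ ModuleCat.{u} Sᵐᵒᵖ) : Prop :=
  IsGradedMod 𝒜 ℬ φ ∧ φ.IsEquivalence

/-- The graded rings `(R, 𝒜)` and `(S, ℬ)` are graded Morita equivalent: there are graded equivalences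
both between the categories of modules and between the categories of graded modules. -/
def GradedMoritaEquivalent (𝒜 : ℤ → AddSubgroup R) (ℬ : ℤ → AddSubgroup S) : Prop :=
  (∃ φ : ModuleCat.{u} Rᵐᵒᵖ ⥤ ModuleCat.{u} Sᵐᵒᵖ, IsGradedEquivMod 𝒜 ℬ φ) ∧
    ∃ Φ : GrMod 𝒜 ⥤ GrMod ℬ, IsGradedEquivGr Φ

end GrMod

/-! Write Y_M = M ⊗ L_k(F) and Y_N = N ⊗ L_k(E) for the bridging bimodules of (M, σ_M) and (N, σ_N).
They are inverse to each other. Since no vertex is a sink, multiplication kE¹ ⊗ L_k(E) → L_k(E) is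
bijective, with inverse y ↦ ∑ f ⊗ f*y (`rho`). Iterating this gives Y_M ⊗ Y_N ≅ M ⊗ N ⊗ L_k(E) ≅
(kE¹)^{⊗n} ⊗ L_k(E) ≅ L_k(E), where the middle step is ω_E (`compositeEquiv`).

This map is visibly linear over kE⁰ on the left and over L_k(E) on the right. The hypothesis on ω_E
is what makes it linear over L_k(E) on the left. An edge acts on M ⊗ N ⊗ L_k(E) through σ_M # σ_N
followed by multiplication of the emerging edge into L_k(E). The hypothesis turns σ_M # σ_N into
ν_n, and ν_n only moves a bracket, so after multiplying out it becomes left multiplication by the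
edge (`powMul_nuSucc`, `compositeEquiv_bridgeIso`). Linearity for ghost edges then follows from ∑
ee* = 1 (`map_smul_of_generators`). Exchanging E and F gives Y_N ⊗ Y_M ≅ L_k(F), so the two tensor
functors are quasi-inverse.

For the gradings, put M in degree 0 and N in degree n. An edge acts on m ⊗ S by sending one edge
into S, which raises the degree by one, and a ghost edge lowers it by one, so Y_M and Y_N are graded
bimodules (`bridgingGrading`). The isomorphisms above preserve degree because ω_E and ω_F take
values in products of n edges (`bridgingComposite_mem`). Hence the same natural isomorphisms exist
on graded modules. Tensoring with a graded bimodule commutes strictly with suspensions, as an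
equality of functors. That the components of L_k(G) form a direct sum is read off from the coaction
x ↦ xtⁿ (`gradeHom`). -/

/-! # Internal gradings of abelian groups -/

namespace InternalGrading

section

variable {X : Type*} [AddCommGroup X] {A : ℤ → AddSubgroup X}

/-- The homomorphism that agrees with `G i` on the component of degree `i`. -/
noncomputable def lift {P : Type*} [AddCommGroup P] (h : DirectSum.IsInternal A)
    (G : ℤ → X →+ P) : X →+ P :=
  (DirectSum.toAddMonoid fun i => (G i).comp (A i).subtype).comp
    (AddEquiv.ofBijective (DirectSum.coeAddMonoidHom A) h).symm.toAddMonoidHom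

theorem lift_apply {P : Type*} [AddCommGroup P] (h : DirectSum.IsInternal A)
    (G : ℤ → X →+ P) {i : ℤ} {x : X} (hx : x ∈ A i) : lift h G x = G i x := by
  have h1 : (AddEquiv.ofBijective (DirectSum.coeAddMonoidHom A) h).symm x =
      DirectSum.of (fun i => A i) i ⟨x, hx⟩ := by
    rw [AddEquiv.symm_apply_eq]
    exact (DirectSum.coeAddMonoidHom_of A i ⟨x, hx⟩).symm
  change DirectSum.toAddMonoid _ ((AddEquiv.ofBijective (DirectSum.coeAddMonoidHom A) h).symm x) = _
  rw [h1, DirectSum.toAddMonoid_of]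
  rfl

/-- Only generation by the components is assumed, not independence: it is all that the tensor
functors below require of the gradings of the rings. -/
theorem induction (h : ⨆ i, A i = ⊤) {p : X → Prop} (hom : ∀ i, ∀ x ∈ A i, p x)
    (add : ∀ x y, p x → p y → p (x + y)) (x : X) : p x := by
  have hx : x ∈ ⨆ i, A i := h ▸ AddSubgroup.mem_top x
  exact AddSubgroup.iSup_induction A (C := p) hx hom (hom 0 0 (zero_mem _)) add

theorem iSup_eq_top (h : DirectSum.IsInternal A) : ⨆ i, A i = ⊤ := by
  have h' : DirectSum.IsInternal fun i => AddSubgroup.toIntSubmodule (A i) := h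
  apply (AddSubgroup.toIntSubmodule (M := X)).injective
  rw [map_iSup, map_top]
  exact h'.submodule_iSup_eq_top

/-- Maps that act as projections on homogeneous elements recover each entry of a formal sum from its
value, which gives independence. This criterion proves directness for tensor products, for L_k(G)
and for the bridging bimodules. -/
theorem of_proj (π : ℤ → X →+ X) (hπ : ∀ i j, ∀ x ∈ A j, π i x = if j = i then x else 0)
    (h : ⨆ i, A i = ⊤) : DirectSum.IsInternal A := by
  constructor
  · rw [injective_iff_map_eq_zero]
    intro d hd
    have key : ∀ i, π i (DirectSum.coeAddMonoidHom A d) = d i := by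
      intro i
      clear hd
      induction d using DirectSum.induction_on with
      | zero => simp
      | of j x =>
        rw [DirectSum.coeAddMonoidHom_of, hπ i j x x.2]
        split_ifs with hij
        · subst hij
          simp
        · rw [DirectSum.of_eq_of_ne _ _ _ (Ne.symm hij)]
          rfl
      | add x y hx hy => simp [hx, hy]
    ext i
    rw [← key i, hd]
    simp
  · rw [← AddMonoidHom.range_eq_top, eq_top_iff, ← h, iSup_le_iff]
    exact fun i x hx => ⟨DirectSum.of (fun i => A i) i ⟨x, hx⟩, DirectSum.coeAddMonoidHom_of A i _⟩

/-- The projection onto the component of degree `i`. -/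
noncomputable def proj (h : DirectSum.IsInternal A) (i : ℤ) : X →+ X :=
  lift h fun j => if j = i then AddMonoidHom.id X else 0

theorem proj_apply (h : DirectSum.IsInternal A) (i : ℤ) {j : ℤ} {x : X} (hx : x ∈ A j) :
    proj h i x = if j = i then x else 0 := by
  rw [proj, lift_apply h _ hx]
  split_ifs <;> rfl

theorem proj_mem (h : DirectSum.IsInternal A) (i : ℤ) (x : X) : proj h i x ∈ A i := by
  induction x using induction (iSup_eq_top h) with
  | hom j x hx =>
    rw [proj_apply h i hx]
    split_ifs with hij
    · exact hij ▸ hx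
    · exact zero_mem _
  | add x y hx hy =>
    rw [map_add]
    exact add_mem hx hy

/-- A degree-preserving map commutes with the projections, so f x and f of the degree `i` part of x
coincide, and injectivity finishes. It follows that the inverse of a degree-preserving bijection
preserves degrees. -/
theorem mem_of_map_mem {X' : Type*} [AddCommGroup X'] {A' : ℤ → AddSubgroup X'}
    (h : DirectSum.IsInternal A) (h' : DirectSum.IsInternal A') (f : X →+ X')
    (hf : Function.Injective f) (hdeg : ∀ i, ∀ x ∈ A i, f x ∈ A' i) {i : ℤ} {x : X}
    (hx : f x ∈ A' i) : x ∈ A i := by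
  have key : ∀ x, f (proj h i x) = proj h' i (f x) := by
    intro x
    induction x using induction (iSup_eq_top h) with
    | hom j x hx =>
      rw [proj_apply h i hx, proj_apply h' i (hdeg j x hx)]
      split_ifs
      · rfl
      · exact map_zero f
    | add x y hx hy => simp only [map_add, hx, hy]
  have h1 : f (proj h i x) = f x := by rw [key, proj_apply h' i hx, if_pos rfl]
  rw [← hf h1]
  exact proj_mem h i x

end

end InternalGrading

/-! # Graded bimodules and graded tensor functors -/

namespace Bimodule

section

variable {k R S : Type u} [CommRing k] [Ring R] [Ring S] [Algebra k R] [Algebra k S]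

/-- A `ℤ`-grading of a bimodule over graded rings. -/
structure Grading (𝒜 : ℤ → AddSubgroup R) (ℬ : ℤ → AddSubgroup S) (Y : Bimodule k R S) where
  gr : ℤ → AddSubgroup Y
  isInternal : DirectSum.IsInternal gr
  lsmul_mem : ∀ {i j : ℤ} {r : R} {y : Y}, r ∈ 𝒜 i → y ∈ gr j → r • y ∈ gr (i + j)
  rsmul_mem : ∀ {i j : ℤ} {y : Y} {s : S}, y ∈ gr i → s ∈ ℬ j → op s • y ∈ gr (i + j)

variable {𝒜 : ℤ → AddSubgroup R} {ℬ : ℤ → AddSubgroup S} {Y : Bimodule k R S}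

namespace Grading

/-- The component of degree `i` of `X ⊗_R Y`. -/
noncomputable def tensorGr (g : Grading 𝒜 ℬ Y) (X : GrMod 𝒜) (i : ℤ) :
    AddSubgroup (tensorObj Y X.toMod) :=
  AddSubgroup.closure {z | ∃ (a b : ℤ) (x : X.toMod) (y : Y),
    a + b = i ∧ x ∈ X.gr a ∧ y ∈ g.gr b ∧ z = RTensor.tmul R x y}

theorem tmul_mem (g : Grading 𝒜 ℬ Y) (X : GrMod 𝒜) {i a b : ℤ} (h : a + b = i) {x : X.toMod}
    {y : Y} (hx : x ∈ X.gr a) (hy : y ∈ g.gr b) :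
    (show tensorObj Y X.toMod from RTensor.tmul R x y) ∈ g.tensorGr X i :=
  AddSubgroup.subset_closure ⟨a, b, x, y, h, hx, hy, rfl⟩

/-- The biadditive map that sends `(x, y)` to `x ⊗ y` if the degrees of `x` and `y` have sum `i`, and
to `0` otherwise. -/
noncomputable def biproj (g : Grading 𝒜 ℬ Y) (X : GrMod 𝒜) (i : ℤ) :
    X.toMod →+ Y →+ RTensor R X.toMod Y :=
  -- For fixed degree `a`, the inner lift decomposes y with values in additive maps of x; flipping
  -- puts x back first.
  InternalGrading.lift X.isInternal fun a => AddMonoidHom.flip <|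
    InternalGrading.lift g.isInternal fun b => if a + b = i then
      AddMonoidHom.mk' (fun y => AddMonoidHom.mk' (fun x => RTensor.tmul R x y)
          (fun x x' => RTensor.add_tmul R x x' y))
        (fun y y' => by ext x; exact RTensor.tmul_add R x y y')
    else 0

theorem biproj_apply (g : Grading 𝒜 ℬ Y) (X : GrMod 𝒜) (i : ℤ) {a b : ℤ} {x : X.toMod}
    {y : Y} (hx : x ∈ X.gr a) (hy : y ∈ g.gr b) :
    g.biproj X i x y = if a + b = i then RTensor.tmul R x y else 0 := by
  rw [biproj, InternalGrading.lift_apply X.isInternal _ hx, AddMonoidHom.flip_apply,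
    InternalGrading.lift_apply g.isInternal _ hy]
  split_ifs <;> rfl

/-- Both sides are additive in x, r and y, so all three may be taken homogeneous; then the two
degree conditions agree by associativity of addition. -/
theorem biproj_smul (g : Grading 𝒜 ℬ Y) (h𝒜 : ⨆ i, 𝒜 i = ⊤) (X : GrMod 𝒜) (i : ℤ) (x : X.toMod)
    (r : R) (y : Y) : g.biproj X i (op r • x) y = g.biproj X i x (r • y) := by
  induction x using InternalGrading.induction (InternalGrading.iSup_eq_top X.isInternal) with
  | hom a x hx =>
    induction y using InternalGrading.induction (InternalGrading.iSup_eq_top g.isInternal) with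
    | hom b y hy =>
      induction r using InternalGrading.induction h𝒜 with
      | hom c r hr =>
        rw [g.biproj_apply X i (X.smul_mem hx hr) hy, g.biproj_apply X i hx (g.lsmul_mem hr hy),
          RTensor.smul_tmul, add_assoc]
      | add r r' hr hr' =>
        rw [MulOpposite.op_add, add_smul, add_smul, map_add, map_add, AddMonoidHom.add_apply, hr, hr']
    | add y y' hy hy' => rw [smul_add, map_add, map_add, hy, hy']
  | add x x' hx hx' =>
    rw [smul_add, map_add, map_add, AddMonoidHom.add_apply, AddMonoidHom.add_apply, hx, hx']

/-- The projection of `X ⊗_R Y` onto its component of degree `i`. -/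
noncomputable def tensorProj (g : Grading 𝒜 ℬ Y) (h𝒜 : ⨆ i, 𝒜 i = ⊤) (X : GrMod 𝒜) (i : ℤ) :
    tensorObj Y X.toMod →+ tensorObj Y X.toMod :=
  RTensor.lift R (g.biproj X i) (g.biproj_smul h𝒜 X i)

/-- Independence is not formal, as X ⊗_R Y is a quotient. The bihomogeneous projections are balanced
over R, hence descend to this quotient and meet the criterion `of_proj`. -/
theorem isInternal_tensorGr (g : Grading 𝒜 ℬ Y) (h𝒜 : ⨆ i, 𝒜 i = ⊤) (X : GrMod 𝒜) :
    DirectSum.IsInternal (g.tensorGr X) := by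
  refine InternalGrading.of_proj (g.tensorProj h𝒜 X) (fun i j z hz => ?_) ?_
  · induction hz using AddSubgroup.closure_induction with
    | mem z hz =>
      obtain ⟨a, b, x, y, rfl, hx, hy, rfl⟩ := hz
      exact g.biproj_apply X i hx hy
    | zero => rw [map_zero, ite_self]
    | add z w _ _ hz hw =>
      rw [map_add, hz, hw]
      split_ifs
      · rfl
      · exact add_zero 0
    | neg z _ hz =>
      rw [map_neg, hz]
      split_ifs
      · rfl
      · exact neg_zero
  · rw [eq_top_iff]
    intro z _
    induction z using RTensor.induction with
    | h0 => exact zero_mem _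
    | ht x y =>
      induction x using InternalGrading.induction (InternalGrading.iSup_eq_top X.isInternal) with
      | hom a x hx =>
        induction y using InternalGrading.induction (InternalGrading.iSup_eq_top g.isInternal) with
        | hom b y hy => exact AddSubgroup.mem_iSup_of_mem (a + b) (g.tmul_mem X rfl hx hy)
        | add y y' hy hy' =>
          rw [RTensor.tmul_add]
          exact add_mem (hy trivial) (hy' trivial)
      | add x x' hx hx' =>
        rw [RTensor.add_tmul]
        exact add_mem (hx trivial) (hx' trivial)
    | ha z w hz hw => exact add_mem (hz trivial) (hw trivial)

theorem smul_mem_tensorGr (g : Grading 𝒜 ℬ Y) (X : GrMod 𝒜) {i j : ℤ}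
    {z : tensorObj Y X.toMod} {s : S} (hz : z ∈ g.tensorGr X i) (hs : s ∈ ℬ j) :
    op s • z ∈ g.tensorGr X (i + j) := by
  induction hz using AddSubgroup.closure_induction with
  | mem z hz =>
    obtain ⟨a, b, x, y, rfl, hx, hy, rfl⟩ := hz
    exact g.tmul_mem X (add_assoc a b j).symm hx (g.rsmul_mem hy hs)
  | zero =>
    rw [smul_zero]
    exact zero_mem _
  | add z w _ _ hz hw =>
    rw [smul_add]
    exact add_mem hz hw
  | neg z _ hz =>
    rw [smul_neg]
    exact neg_mem hz

/-- The functor `X ↦ X ⊗_R Y` between categories of graded modules, for a graded bimodule `Y`. -/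
noncomputable def tensorFunctor (g : Grading 𝒜 ℬ Y) (h𝒜 : ⨆ i, 𝒜 i = ⊤) :
    GrMod 𝒜 ⥤ GrMod ℬ where
  obj X :=
    { toMod := tensorObj Y X.toMod
      gr := g.tensorGr X
      isInternal := g.isInternal_tensorGr h𝒜 X
      smul_mem := g.smul_mem_tensorGr X }
  map {X X'} f := ⟨tensorObjMap Y f.1, fun i z hz => by
    induction hz using AddSubgroup.closure_induction with
    | mem z hz =>
      obtain ⟨a, b, x, y, rfl, hx, hy, rfl⟩ := hz
      exact g.tmul_mem X' rfl (f.2 a x hx) hy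
    | zero =>
      rw [map_zero]
      exact zero_mem _
    | add z w _ _ hz hw =>
      rw [map_add]
      exact add_mem hz hw
    | neg z _ hz =>
      rw [map_neg]
      exact neg_mem hz⟩
  map_id X := Subtype.ext ((Bimodule.tensorFunctor Y).map_id X.toMod)
  map_comp f f' := Subtype.ext ((Bimodule.tensorFunctor Y).map_comp f.1 f'.1)

theorem tensorFunctor_comp_forgetGrading (g : Grading 𝒜 ℬ Y) (h𝒜 : ⨆ i, 𝒜 i = ⊤) :
    g.tensorFunctor h𝒜 ⋙ GrMod.forgetGrading ℬ =
      GrMod.forgetGrading 𝒜 ⋙ Bimodule.tensorFunctor Y := rfl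

/-- The generating sets coincide after shifting the degree of x by `γ`. An equality of subgroups is
needed, since graded functors commute with suspensions on the nose. -/
theorem tensorGr_suspension (g : Grading 𝒜 ℬ Y) (X : GrMod 𝒜) (γ i : ℤ) :
    g.tensorGr X (γ + i) = g.tensorGr ((GrMod.suspension 𝒜 γ).obj X) i := by
  apply congrArg AddSubgroup.closure
  ext z
  constructor
  · rintro ⟨a, b, x, y, h, hx, hy, rfl⟩
    refine ⟨a - γ, b, x, y, by linarith, ?_, hy, rfl⟩
    change x ∈ X.gr (γ + (a - γ))
    rwa [add_sub_cancel]
  · rintro ⟨a, b, x, y, h, hx, hy, rfl⟩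
    exact ⟨γ + a, b, x, y, by linarith, hx, hy, rfl⟩

end Grading

end

end Bimodule

/-! ### Equality of graded functors and isomorphisms of graded modules -/

namespace GrMod

section

variable {R S : Type u} [Ring R] [Ring S] {𝒜 : ℤ → AddSubgroup R} {ℬ : ℤ → AddSubgroup S}

theorem hext {X X' : GrMod 𝒜} (h : X.toMod = X'.toMod) (h' : X.gr ≍ X'.gr) : X = X' := by
  cases X
  cases X'
  cases h
  cases h'
  rfl

/-- A morphism of graded modules is determined by its underlying homomorphism, and the forgetful
functor carries `eqToHom` to `eqToHom`, so the transports can be compared on underlying modules. -/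
theorem functor_ext {Φ Ψ : GrMod 𝒜 ⥤ GrMod ℬ} (h : ∀ X, (Φ.obj X).toMod = (Ψ.obj X).toMod)
    (hgr : ∀ X, (Φ.obj X).gr ≍ (Ψ.obj X).gr)
    (hmap : ∀ {X X'} (f : X ⟶ X'), (Φ.map f).1 = eqToHom (h X) ≫ (Ψ.map f).1 ≫ eqToHom (h X').symm) :
    Φ = Ψ := by
  refine CategoryTheory.Functor.ext (fun X => hext (h X) (hgr X)) fun X X' f => ?_
  apply (Subtype.ext : _ → _)
  rw [hmap]
  change _ = (forgetGrading ℬ).map (eqToHom _ ≫ Ψ.map f ≫ eqToHom _)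
  rw [Functor.map_comp, Functor.map_comp, eqToHom_map, eqToHom_map]
  rfl

theorem isGradedGr_tensorFunctor {k : Type u} [CommRing k] [Algebra k R] [Algebra k S]
    {Y : Bimodule k R S} (g : Bimodule.Grading 𝒜 ℬ Y) (h𝒜 : ⨆ i, 𝒜 i = ⊤) :
    IsGradedGr (g.tensorFunctor h𝒜) := fun γ => by
  refine functor_ext (fun X => rfl)
    (fun X => heq_of_eq (funext fun i => g.tensorGr_suspension X γ i)) fun f => ?_
  exact ((Category.id_comp _).trans (Category.comp_id _)).symm

/-- A degree-preserving bijective homomorphism is an isomorphism of graded modules. -/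
noncomputable def isoOfBijective {X X' : GrMod 𝒜} (f : X ⟶ X')
    (hf : Function.Bijective f.1.hom) : X ≅ X' where
  hom := f
  inv := ⟨ModuleCat.ofHom (LinearEquiv.ofBijective f.1.hom hf).symm.toLinearMap, fun i x hx => by
    refine InternalGrading.mem_of_map_mem X.isInternal X'.isInternal f.1.hom.toAddMonoidHom hf.1
      f.2 ?_
    change (LinearEquiv.ofBijective f.1.hom hf) ((LinearEquiv.ofBijective f.1.hom hf).symm x) ∈ _
    rwa [LinearEquiv.apply_symm_apply]⟩
  hom_inv_id := by
    apply (Subtype.ext : _ → _)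
    apply ModuleCat.hom_ext
    exact LinearMap.ext (LinearEquiv.ofBijective f.1.hom hf).symm_apply_apply
  inv_hom_id := by
    apply (Subtype.ext : _ → _)
    apply ModuleCat.hom_ext
    exact LinearMap.ext (LinearEquiv.ofBijective f.1.hom hf).apply_symm_apply

end

end GrMod

/-! ### Inverse bimodules and Morita equivalences -/

namespace Bimodule

section

variable {k R S : Type u} [CommRing k] [Ring R] [Ring S] [Algebra k R] [Algebra k S]

variable (k R) in
/-- The ring `R` as an `R`-`R`-bimodule. -/
def regular : Bimodule k R R where
  carrier := R
  central c x := Algebra.commutes c x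

/-- The element of `R` underlying an element of the bimodule `R`. -/
def regularVal (r : regular k R) : R := r

/-- A right `R`-module as a `k`-`R`-bimodule. -/
def ofModuleCat (k : Type u) [CommRing k] [Algebra k R] (X : ModuleCat.{u} Rᵐᵒᵖ) :
    Bimodule k k R :=
  -- Letting k act through R turns a right module into a bimodule, so that the associativity and
  -- unit isomorphisms of bimodules apply to it.
  letI : Module k X := Module.compHom X (algebraMap k Rᵐᵒᵖ)
  { carrier := X
    smulComm := ⟨fun c r x => by
      change algebraMap k Rᵐᵒᵖ c • r • x = r • algebraMap k Rᵐᵒᵖ c • x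
      rw [smul_smul, smul_smul, Algebra.commutes]⟩
    central := fun c x => rfl }

/-- The map `X ⊗_R R → X`. -/
noncomputable def rightUnitorHom {A : Type u} [Ring A] [Algebra k A] (X : Bimodule k A R) :
    (X ⊠ regular k R : Bimodule k A R) →+ X :=
  tensorLift (fun x (r : R) => op r • x) (fun x x' _ => smul_add _ x x')
    (fun x (r r' : R) => add_smul (op r) (op r') x)
    (fun x b r => (mul_smul (op (regularVal r)) (op b) x).symm)

/-- The isomorphism `X ⊗_R R ≅ X`. -/
noncomputable def rightUnitor {A : Type u} [Ring A] [Algebra k A] (X : Bimodule k A R) :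
    X ⊠ regular k R ≃ᵇ X where
  toFun := rightUnitorHom X
  invFun x := tmul x ((1 : R) : regular k R)
  left_inv := tensor_hom_ext
    (F := (AddMonoidHom.mk' (fun x => (tmul x ((1 : R) : regular k R) : (X ⊠ regular k R :)))
      (fun x x' => add_tmul x x' _)).comp (rightUnitorHom X))
    (G := AddMonoidHom.id _) fun x r =>
      (tmul_balanced (regularVal r) x (show regular k R from (1 : R))).trans
        (congrArg (tmul x) (mul_one (regularVal r)))
  right_inv x := one_smul Rᵐᵒᵖ x
  map_add' := map_add _
  map_lsmul := tensor_map_lsmul (rightUnitorHom X) fun a x (r : R) => (smul_comm a (op r) x).symm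
  map_rsmul := tensor_map_rsmul (rightUnitorHom X) fun c x (r : R) => mul_smul c (op r) x

variable {Y : Bimodule k R S} {Z : Bimodule k S R}

/-- The biadditive map `(x, y) ↦ x ⊗ y` into the module `X ⊗_R Y`. -/
noncomputable def objTmul (Y : Bimodule k R S) (X : ModuleCat.{u} Rᵐᵒᵖ) :
    X →+ Y →+ tensorObj Y X :=
  AddMonoidHom.mk' (fun x => AddMonoidHom.mk' (fun y => (RTensor.tmul R x y : tensorObj Y X))
      (fun y y' => RTensor.tmul_add R x y y'))
    (fun x x' => by ext y; exact RTensor.add_tmul R x x' y)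

theorem tensorObj_hom_ext {P : Type*} [AddCommGroup P] {X : ModuleCat.{u} Rᵐᵒᵖ}
    {f g : tensorObj Y X →+ P}
    (h : ∀ (x : X) (y : Y), f (objTmul Y X x y) = g (objTmul Y X x y)) : f = g := by
  ext w
  induction w using RTensor.induction with
  | h0 => exact (map_zero f).trans (map_zero g).symm
  | ht v z => exact h v z
  | ha w w' hw hw' =>
    exact ((map_add f _ _).trans (congrArg₂ (· + ·) hw hw')).trans (map_add g _ _).symm

theorem tensorObj_tensorObj_hom_ext {P : Type*} [AddCommGroup P] {X : ModuleCat.{u} Rᵐᵒᵖ}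
    {f g : tensorObj Z (tensorObj Y X) →+ P}
    (h : ∀ (x : X) (y : Y) (z : Z), f (objTmul Z (tensorObj Y X) (objTmul Y X x y) z) =
      g (objTmul Z (tensorObj Y X) (objTmul Y X x y) z)) : f = g :=
  tensorObj_hom_ext fun v z => DFunLike.congr_fun (tensorObj_hom_ext
    (f := f.comp ((objTmul Z (tensorObj Y X)).flip z))
    (g := g.comp ((objTmul Z (tensorObj Y X)).flip z)) fun x y => h x y z) v

/-- The isomorphism `(X ⊗_R Y) ⊗_S Z ≅ X ⊗_R (Y ⊗_S Z) ≅ X ⊗_R R ≅ X` of bimodules induced by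
`θ : Y ⊗_S Z ≅ R`. -/
noncomputable def cancelEquiv (θ : Y ⊠ Z ≃ᵇ regular k R) (X : ModuleCat.{u} Rᵐᵒᵖ) :
    (ofModuleCat k X ⊠ Y) ⊠ Z ≃ᵇ ofModuleCat k X :=
  (assoc (ofModuleCat k X) Y Z).trans <|
    (tensorCongr (Equiv.refl _) θ).trans (rightUnitor (ofModuleCat k X))

/-- `cancelEquiv` as an isomorphism of right modules. -/
noncomputable def cancelLinearEquiv (θ : Y ⊠ Z ≃ᵇ regular k R) (X : ModuleCat.{u} Rᵐᵒᵖ) :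
    tensorObj Z (tensorObj Y X) ≃ₗ[Rᵐᵒᵖ] X where
  toFun := cancelEquiv θ X
  invFun := (cancelEquiv θ X).symm
  map_add' := (cancelEquiv θ X).apply_add
  map_smul' := (cancelEquiv θ X).map_rsmul
  left_inv := (cancelEquiv θ X).symm_apply
  right_inv := (cancelEquiv θ X).apply_symm

/-- On (x ⊗ y) ⊗ z the two sides are f(x)·θ(y ⊗ z) and f(x·θ(y ⊗ z)), so naturality is the
R-linearity of f. -/
theorem cancelLinearEquiv_naturality (θ : Y ⊠ Z ≃ᵇ regular k R) {X X' : ModuleCat.{u} Rᵐᵒᵖ}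
    (f : X ⟶ X') :
    (tensorFunctor Z).map ((tensorFunctor Y).map f) ≫ (cancelLinearEquiv θ X').toModuleIso.hom =
      (cancelLinearEquiv θ X).toModuleIso.hom ≫ f := by
  apply ModuleCat.hom_ext
  apply LinearMap.toAddMonoidHom_injective
  exact tensorObj_tensorObj_hom_ext fun x y z => (f.hom.map_smul (op (regularVal (θ (tmul y z)))) x).symm

/-- An isomorphism `Y ⊗_S Z ≅ R` makes `- ⊗_S Z` a left inverse of `- ⊗_R Y`. -/
noncomputable def cancelNatIso (θ : Y ⊠ Z ≃ᵇ regular k R) :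
    tensorFunctor Y ⋙ tensorFunctor Z ≅ 𝟭 (ModuleCat.{u} Rᵐᵒᵖ) :=
  NatIso.ofComponents (fun X => (cancelLinearEquiv θ X).toModuleIso)
    fun f => cancelLinearEquiv_naturality θ f

/-- No compatibility between `θ` and `θ'` is required: `Equivalence.mk` corrects the unit so that
the triangle identities hold. -/
theorem isEquivalence_tensorFunctor (θ : Y ⊠ Z ≃ᵇ regular k R) (θ' : Z ⊠ Y ≃ᵇ regular k S) :
    (tensorFunctor Y).IsEquivalence :=
  (CategoryTheory.Equivalence.mk (tensorFunctor Y) (tensorFunctor Z) (cancelNatIso θ).symm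
    (cancelNatIso θ')).isEquivalence_functor

/-! ### Degrees under the cancellation isomorphisms -/

namespace Grading

variable {𝒜 : ℤ → AddSubgroup R} {ℬ : ℤ → AddSubgroup S}

/-- The map is (x ⊗ y) ⊗ z ↦ x·θ(y ⊗ z), and `hθ` gives the degree of the scalar. -/
theorem cancelLinearEquiv_mem (gY : Grading 𝒜 ℬ Y) (gZ : Grading ℬ 𝒜 Z) (h𝒜 : ⨆ i, 𝒜 i = ⊤)
    (θ : Y ⊠ Z ≃ᵇ regular k R)
    (hθ : ∀ {a b : ℤ} {y : Y} {z : Z}, y ∈ gY.gr a → z ∈ gZ.gr b →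
      regularVal (θ (tmul y z)) ∈ 𝒜 (a + b))
    (X : GrMod 𝒜) (i : ℤ) :
    gZ.tensorGr ((gY.tensorFunctor h𝒜).obj X) i ≤
      (X.gr i).comap (cancelLinearEquiv θ X.toMod).toLinearMap.toAddMonoidHom := by
  refine (AddSubgroup.closure_le _).mpr ?_
  rintro _ ⟨a, b, v, z, rfl, hv, hz, rfl⟩
  -- The left factor v is homogeneous in X ⊗ Y but need not be a pure tensor; with z fixed the map
  -- is additive in v, so v may be replaced by generators.
  let F : tensorObj Y X.toMod →+ X.toMod :=
    (cancelLinearEquiv θ X.toMod).toLinearMap.toAddMonoidHom.comp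
      ((objTmul Z (tensorObj Y X.toMod)).flip z)
  suffices h : gY.tensorGr X a ≤ (X.gr (a + b)).comap F from h hv
  refine (AddSubgroup.closure_le _).mpr ?_
  rintro _ ⟨a, c, x, y, rfl, hx, hy, rfl⟩
  rw [add_assoc]
  exact X.smul_mem hx (hθ hy hz)

/-- The graded version of `cancelNatIso`. -/
noncomputable def cancelNatIso (gY : Grading 𝒜 ℬ Y) (gZ : Grading ℬ 𝒜 Z) (h𝒜 : ⨆ i, 𝒜 i = ⊤)
    (hℬ : ⨆ i, ℬ i = ⊤) (θ : Y ⊠ Z ≃ᵇ regular k R)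
    (hθ : ∀ {a b : ℤ} {y : Y} {z : Z}, y ∈ gY.gr a → z ∈ gZ.gr b →
      regularVal (θ (tmul y z)) ∈ 𝒜 (a + b)) :
    gY.tensorFunctor h𝒜 ⋙ gZ.tensorFunctor hℬ ≅ 𝟭 (GrMod 𝒜) :=
  NatIso.ofComponents
    (fun X => GrMod.isoOfBijective (X' := X)
      ⟨(cancelLinearEquiv θ X.toMod).toModuleIso.hom,
        fun i _ hz => gY.cancelLinearEquiv_mem gZ h𝒜 θ hθ X i hz⟩
      (cancelLinearEquiv θ X.toMod).bijective)
    fun f => Subtype.ext (cancelLinearEquiv_naturality θ f.1)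

/-- The Morita criterion applied at the end: a pair of inverse graded bimodules whose cancellation
isomorphisms preserve degree yields the graded and the ungraded equivalence from the same maps. -/
theorem isGradedEquiv_tensorFunctor (gY : Grading 𝒜 ℬ Y) (gZ : Grading ℬ 𝒜 Z)
    (h𝒜 : ⨆ i, 𝒜 i = ⊤) (hℬ : ⨆ i, ℬ i = ⊤) (θ : Y ⊠ Z ≃ᵇ regular k R)
    (θ' : Z ⊠ Y ≃ᵇ regular k S)
    (hθ : ∀ {a b : ℤ} {y : Y} {z : Z}, y ∈ gY.gr a → z ∈ gZ.gr b →
      regularVal (θ (tmul y z)) ∈ 𝒜 (a + b))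
    (hθ' : ∀ {a b : ℤ} {z : Z} {y : Y}, z ∈ gZ.gr a → y ∈ gY.gr b →
      regularVal (θ' (tmul z y)) ∈ ℬ (a + b)) :
    GrMod.GradedMoritaEquivalent 𝒜 ℬ ∧ GrMod.IsGradedEquivMod 𝒜 ℬ (Bimodule.tensorFunctor Y) := by
  have h : GrMod.IsGradedEquivMod 𝒜 ℬ (Bimodule.tensorFunctor Y) :=
    ⟨⟨gY.tensorFunctor h𝒜, GrMod.isGradedGr_tensorFunctor gY h𝒜,
      gY.tensorFunctor_comp_forgetGrading h𝒜⟩, isEquivalence_tensorFunctor θ θ'⟩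
  exact ⟨⟨⟨_, h⟩, gY.tensorFunctor h𝒜, GrMod.isGradedGr_tensorFunctor gY h𝒜,
    gZ.tensorFunctor hℬ, GrMod.isGradedGr_tensorFunctor gZ hℬ,
    ⟨gY.cancelNatIso gZ h𝒜 hℬ θ hθ⟩, ⟨gZ.cancelNatIso gY hℬ h𝒜 θ' hθ'⟩⟩, h⟩

end Grading

end

end Bimodule

/-! # The grading of the Leavitt path algebra -/

namespace FinGraph.Leavitt

section

variable {k : Type u} [Field k] {G : FinGraph.{u}}

theorem induction_on {p : Leavitt k G → Prop} (hk : ∀ c : k, p (algebraMap k _ c))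
    (hv : ∀ w, p (v k w)) (he : ∀ f, p (e k f)) (hs : ∀ f, p (eStar k f))
    (hm : ∀ x y, p x → p y → p (x * y)) (ha : ∀ x y, p x → p y → p (x + y)) (x : Leavitt k G) :
    p x := by
  obtain ⟨x, rfl⟩ : ∃ y, mk k G y = x := RingQuot.mkAlgHom_surjective k (LeavittRel k G) x
  induction x using FreeAlgebra.induction with
  | grade0 c =>
    rw [AlgHom.commutes]
    exact hk c
  | grade1 g =>
    cases g with
    | vertex w => exact hv w
    | edge f => exact he f
    | ghost f => exact hs f
  | mul x y hx hy =>
    rw [map_mul]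
    exact hm _ _ hx hy
  | add x y hx hy =>
    rw [map_add]
    exact ha _ _ hx hy

theorem v_mul_path {a b : G.V} (p : Quiver.Path a b) : v k a * path k p = path k p := by
  induction p with
  | nil => exact (v_mul_v k a a).trans (if_pos rfl)
  | cons p f ih => rw [path, ← mul_assoc, ih]

theorem v_mul_pathStar {a b : G.V} (p : Quiver.Path a b) :
    v k b * pathStar k p = pathStar k p := by
  cases p with
  | nil => exact (v_mul_v k a a).trans (if_pos rfl)
  | cons p f =>
    obtain ⟨f, rfl, rfl⟩ := f
    rw [pathStar, ← mul_assoc, v_mul_eStar]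

theorem e_mul_path {a b c : G.V} (f : a ⟶ b) (p : Quiver.Path b c) :
    e k f.1 * path k p = path k (f.toPath.comp p) := by
  induction p with
  | nil =>
    obtain ⟨f, rfl, rfl⟩ := f
    change e k f * v k (G.rng f) = v k (G.src f) * e k f
    rw [e_mul_v, v_mul_e]
  | cons p g ih =>
    rw [Quiver.Path.comp_cons, path, path, ← ih, mul_assoc]

/-- The ghost edge meets the first edge of the path and either cancels it or gives 0. Paths are
built up at their last edge, so the first one is reached by induction on `p`; the surviving path has
one edge less. -/
theorem eStar_mul_path_cons (f : G.E) {a b c : G.V} (p : Quiver.Path a b) (g : b ⟶ c) :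
    eStar k f * path k (p.cons g) = 0 ∨
      ∃ (a' : G.V) (q : Quiver.Path a' c), q.length = p.length ∧
        eStar k f * path k (p.cons g) = path k q := by
  induction p generalizing c with
  | nil =>
    obtain ⟨g, rfl, rfl⟩ := g
    have h : eStar k f * path k (Quiver.Path.nil.cons (⟨g, rfl, rfl⟩ : G.src g ⟶ G.rng g)) =
        if f = g then v k (G.rng f) else 0 := by
      change eStar k f * (v k (G.src g) * e k g) = _
      rw [v_mul_e, eStar_mul_e]
    rw [h]
    split_ifs with hfg
    · subst hfg
      exact Or.inr ⟨_, Quiver.Path.nil, rfl, rfl⟩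
    · exact Or.inl rfl
  | cons p g' ih =>
    rw [path, ← mul_assoc]
    obtain h | ⟨a', q, hq, h⟩ := ih g'
    · rw [h, zero_mul]
      exact Or.inl rfl
    · rw [h]
      exact Or.inr ⟨a', q.cons g, by simp [hq], rfl⟩

theorem path_mul_pathStar_mem {a b c : G.V} (α : Quiver.Path a c) (β : Quiver.Path b c) {n : ℤ}
    (h : (α.length : ℤ) - β.length = n) : path k α * pathStar k β ∈ grading k G n :=
  Submodule.subset_span ⟨a, b, c, α, β, h, rfl⟩

theorem smul_mem_grading (c : k) {n : ℤ} {x : Leavitt k G} (hx : x ∈ grading k G n) :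
    c • x ∈ grading k G n :=
  Submodule.smul_mem _ c hx

theorem v_mem (w : G.V) : v k w ∈ grading k G 0 := by
  have h := path_mul_pathStar_mem (k := k) (Quiver.Path.nil : Quiver.Path w w) .nil (n := 0) rfl
  rwa [path, pathStar, v_mul_v, if_pos rfl] at h

theorem one_mem : (1 : Leavitt k G) ∈ grading k G 0 := by
  rw [← sum_v]
  exact sum_mem fun w _ => v_mem w

theorem e_mem (f : G.E) : e k f ∈ grading k G 1 := by
  have h := path_mul_pathStar_mem (k := k) (Quiver.Path.nil.cons (⟨f, rfl, rfl⟩ : G.src f ⟶ G.rng f))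
    .nil (n := 1) rfl
  rw [path, path, pathStar] at h
  rwa [v_mul_e, e_mul_v] at h

theorem ofEdge_mem (x : edgeBim k G) : ofEdge k x ∈ grading k G 1 := by
  rw [ofEdge_apply]
  exact sum_mem fun f _ => smul_mem_grading _ (e_mem f)

/-- The component is a span over k while `F` is only additive, so scalars cannot be taken out of
`F`. They are kept inside the generators, and the induction runs over all coefficients at once. -/
theorem grading_le_comap {P : Type*} [AddCommGroup P] (F : Leavitt k G →+ P) {n : ℤ}
    {B : AddSubgroup P}
    (h : ∀ (c : k) {a b d : G.V} (α : Quiver.Path a d) (β : Quiver.Path b d),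
      (α.length : ℤ) - β.length = n → F (algebraMap k _ c * (path k α * pathStar k β)) ∈ B)
    {x : Leavitt k G} (hx : x ∈ grading k G n) : F x ∈ B := by
  suffices h' : ∀ c : k, F (algebraMap k _ c * x) ∈ B by simpa using h' 1
  change x ∈ Submodule.span k _ at hx
  induction hx using Submodule.span_induction with
  | mem x hx =>
    obtain ⟨a, b, d, α, β, hn, rfl⟩ := hx
    exact fun c => h c α β hn
  | zero =>
    intro c
    rw [mul_zero, map_zero]
    exact zero_mem B
  | add x y _ _ hx hy =>
    intro c
    rw [mul_add, map_add]
    exact add_mem (hx c) (hy c)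
  | smul c' x _ hx =>
    intro c
    rw [Algebra.smul_def, ← mul_assoc, ← (algebraMap k (Leavitt k G)).map_mul]
    exact hx (c * c')

/-- A left module over the Leavitt path algebra is graded as soon as the generators act
homogeneously. -/
theorem smul_mem_of_generators {P : Type*} [AddCommGroup P] [Module (Leavitt k G) P]
    {gr : ℤ → AddSubgroup P}
    (hk : ∀ (c : k) {j : ℤ} {y : P}, y ∈ gr j → algebraMap k (Leavitt k G) c • y ∈ gr j)
    (hv : ∀ (w : G.V) {j : ℤ} {y : P}, y ∈ gr j → v k w • y ∈ gr j)
    (he : ∀ (f : G.E) {j : ℤ} {y : P}, y ∈ gr j → e k f • y ∈ gr (1 + j))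
    (hs : ∀ (f : G.E) {j : ℤ} {y : P}, y ∈ gr j → eStar k f • y ∈ gr (-1 + j))
    {i j : ℤ} {x : Leavitt k G} {y : P} (hx : x ∈ grading k G i) (hy : y ∈ gr j) :
    x • y ∈ gr (i + j) := by
  have hpath : ∀ {a b : G.V} (p : Quiver.Path a b) {j : ℤ} {y : P}, y ∈ gr j →
      path k p • y ∈ gr (p.length + j) := by
    intro a b p
    induction p with
    | nil =>
      intro j y hy
      have := hv a hy
      rwa [← zero_add j] at this
    | cons p f ih =>
      intro j y hy
      have := ih (he f.1 hy)
      rw [path, mul_smul, Quiver.Path.length_cons]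
      push_cast
      rwa [add_assoc]
  have hpathStar : ∀ {a b : G.V} (p : Quiver.Path a b) {j : ℤ} {y : P}, y ∈ gr j →
      pathStar k p • y ∈ gr (-p.length + j) := by
    intro a b p
    induction p with
    | nil =>
      intro j y hy
      have := hv a hy
      rwa [← zero_add j, ← neg_zero] at this
    | cons p f ih =>
      intro j y hy
      have := hs f.1 (ih hy)
      rw [pathStar, mul_smul, Quiver.Path.length_cons]
      push_cast
      rwa [neg_add_rev, add_assoc]
  refine grading_le_comap (AddMonoidHom.mk' (fun x : Leavitt k G => x • y)
    fun x x' => add_smul x x' y) (fun c a b d α β hn => ?_) hx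
  change (algebraMap k (Leavitt k G) c * (path k α * pathStar k β)) • y ∈ gr (i + j)
  rw [mul_smul, mul_smul, ← hn, sub_eq_add_neg, add_assoc]
  exact hk c (hpath α (hpathStar β hy))

theorem algebraMap_mul_mem (c : k) {j : ℤ} {y : Leavitt k G} (hy : y ∈ grading k G j) :
    algebraMap k (Leavitt k G) c * y ∈ grading k G j := by
  rw [← Algebra.smul_def]
  exact smul_mem_grading c hy

theorem v_mul_mem (w : G.V) {j : ℤ} {y : Leavitt k G} (hy : y ∈ grading k G j) :
    v k w * y ∈ grading k G j := by
  refine grading_le_comap (AddMonoidHom.mulLeft (v k w)) (fun c a b d α β hn => ?_) hy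
  change v k w * (algebraMap k (Leavitt k G) c * _) ∈ _
  rw [Algebra.left_comm]
  refine algebraMap_mul_mem c ?_
  rw [← v_mul_path, ← mul_assoc, ← mul_assoc, v_mul_v]
  split_ifs with h
  · subst h
    rw [v_mul_path]
    exact path_mul_pathStar_mem α β hn
  · rw [zero_mul, zero_mul]
    exact zero_mem _

theorem e_mul_mem (f : G.E) {j : ℤ} {y : Leavitt k G} (hy : y ∈ grading k G j) :
    e k f * y ∈ grading k G (1 + j) := by
  refine grading_le_comap (AddMonoidHom.mulLeft (e k f)) (fun c a b d α β hn => ?_) hy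
  change e k f * (algebraMap k (Leavitt k G) c * _) ∈ _
  rw [Algebra.left_comm]
  refine algebraMap_mul_mem c ?_
  by_cases h : G.rng f = a
  · rw [← mul_assoc, e_mul_path (⟨f, rfl, h⟩ : G.src f ⟶ a) α]
    refine path_mul_pathStar_mem _ β ?_
    rw [Quiver.Path.length_comp, Quiver.Hom.toPath, Quiver.Path.length_cons, Quiver.Path.length_nil]
    push_cast
    linarith
  · rw [← v_mul_path, ← e_mul_v]
    simp only [← mul_assoc]
    rw [mul_assoc (e k f), v_mul_v, if_neg h, mul_zero, zero_mul, zero_mul]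
    exact zero_mem _

/-- If α is trivial, then f*β* is (βf)* or 0. Otherwise f* removes the first edge of α or kills the
product. Either way the degree drops by one. -/
theorem eStar_mul_mem (f : G.E) {j : ℤ} {y : Leavitt k G} (hy : y ∈ grading k G j) :
    eStar k f * y ∈ grading k G (-1 + j) := by
  refine grading_le_comap (AddMonoidHom.mulLeft (eStar k f)) (fun c a b d α β hn => ?_) hy
  change eStar k f * (algebraMap k (Leavitt k G) c * _) ∈ _
  rw [Algebra.left_comm]
  refine algebraMap_mul_mem c ?_
  cases α with
  | nil =>
    rw [path, v_mul_pathStar]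
    by_cases h : G.src f = a
    · have h1 : eStar k f * pathStar k β = path k (.nil : Quiver.Path (G.rng f) (G.rng f)) *
          pathStar k (β.cons (⟨f, h, rfl⟩ : a ⟶ G.rng f)) := by
        rw [path, v_mul_pathStar, pathStar]
      rw [h1]
      refine path_mul_pathStar_mem _ _ ?_
      rw [Quiver.Path.length_nil] at hn ⊢
      rw [Quiver.Path.length_cons]
      push_cast at hn ⊢
      linarith
    · rw [← v_mul_pathStar, ← eStar_mul_v, ← mul_assoc, mul_assoc (eStar k f), v_mul_v, if_neg h,
        mul_zero, zero_mul]
      exact zero_mem _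
  | cons p g =>
    rw [← mul_assoc]
    obtain h | ⟨a', q, hq, h⟩ := eStar_mul_path_cons (k := k) f p g
    · rw [h, zero_mul]
      exact zero_mem _
    · rw [h]
      refine path_mul_pathStar_mem q β ?_
      rw [Quiver.Path.length_cons] at hn
      push_cast at hn
      rw [hq]
      linarith

theorem mul_mem {i j : ℤ} {x y : Leavitt k G} (hx : x ∈ grading k G i) (hy : y ∈ grading k G j) :
    x * y ∈ grading k G (i + j) :=
  smul_mem_of_generators (P := Leavitt k G) algebraMap_mul_mem v_mul_mem e_mul_mem eStar_mul_mem
    hx hy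

/-- The sum of the components contains 1 and is stable under left multiplication by scalars and
generators, hence by all of L_k(G). -/
theorem iSup_grading : ⨆ i, grading k G i = ⊤ := by
  have key : ∀ (F : Leavitt k G →+ Leavitt k G),
      (∀ i, ∀ y ∈ grading k G i, F y ∈ ⨆ i, grading k G i) →
        ∀ y ∈ ⨆ i, grading k G i, F y ∈ ⨆ i, grading k G i := by
    intro F hF
    exact iSup_le (a := (⨆ i, grading k G i).comap F) hF
  rw [eq_top_iff]
  intro x _
  suffices h : ∀ y ∈ ⨆ i, grading k G i, x * y ∈ ⨆ i, grading k G i by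
    simpa using h 1 (AddSubgroup.mem_iSup_of_mem 0 one_mem)
  induction x using induction_on with
  | hk c =>
    exact key (AddMonoidHom.mulLeft _) fun i y hy =>
      AddSubgroup.mem_iSup_of_mem i (algebraMap_mul_mem c hy)
  | hv w =>
    exact key (AddMonoidHom.mulLeft _) fun i y hy =>
      AddSubgroup.mem_iSup_of_mem i (v_mul_mem w hy)
  | he f =>
    exact key (AddMonoidHom.mulLeft _) fun i y hy =>
      AddSubgroup.mem_iSup_of_mem _ (e_mul_mem f hy)
  | hs f =>
    exact key (AddMonoidHom.mulLeft _) fun i y hy =>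
      AddSubgroup.mem_iSup_of_mem _ (eStar_mul_mem f hy)
  | hm x x' hx hx' =>
    intro y hy
    rw [mul_assoc]
    exact hx trivial _ (hx' trivial y hy)
  | ha x x' hx hx' =>
    intro y hy
    rw [add_mul]
    exact add_mem (hx trivial y hy) (hx' trivial y hy)

/-! ### Independence of the components of L_k(G) -/

/-- The homogeneous values of the generators in the Laurent polynomial ring over `L_k(G)`. -/
noncomputable def gradeGen : G.Gen → AddMonoidAlgebra (Leavitt k G) ℤ
  | .vertex w => .single 0 (v k w)
  | .edge f => .single 1 (e k f)
  | .ghost f => .single (-1) (eStar k f)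

/-- Each defining relation is homogeneous when v, e and e* have degrees 0, 1 and -1, so it persists
when each generator is multiplied by the matching power of t. -/
theorem lift_gradeGen_rel {x y : FreeGen k G} (h : LeavittRel k G x y) :
    FreeAlgebra.lift k (gradeGen (k := k)) x = FreeAlgebra.lift k (gradeGen (k := k)) y := by
  have hsum : ∀ (ι : Type u) (s : Finset ι) (g : ι → Leavitt k G) (i : ℤ),
      ∑ t ∈ s, AddMonoidAlgebra.single i (g t) = AddMonoidAlgebra.single i (∑ t ∈ s, g t) :=
    fun ι s g i => (map_sum (AddMonoidAlgebra.singleAddHom i) g s).symm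
  cases h with
  | unit =>
    rw [map_sum, map_one]
    simp only [FreeAlgebra.lift_ι_apply, gradeGen]
    rw [hsum, sum_v]
    rfl
  | vertex w w' =>
    simp only [map_mul, apply_ite (FreeAlgebra.lift k (gradeGen (k := k))), map_zero,
      FreeAlgebra.lift_ι_apply, gradeGen, AddMonoidAlgebra.single_mul_single, v_mul_v]
    split_ifs
    · rfl
    · exact AddMonoidAlgebra.single_zero _
  | src_edge f =>
    simp only [map_mul, FreeAlgebra.lift_ι_apply, gradeGen, AddMonoidAlgebra.single_mul_single,
      v_mul_e]
    rfl
  | edge_rng f =>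
    simp only [map_mul, FreeAlgebra.lift_ι_apply, gradeGen, AddMonoidAlgebra.single_mul_single,
      e_mul_v]
    rfl
  | rng_ghost f =>
    simp only [map_mul, FreeAlgebra.lift_ι_apply, gradeGen, AddMonoidAlgebra.single_mul_single,
      v_mul_eStar]
    rfl
  | ghost_src f =>
    simp only [map_mul, FreeAlgebra.lift_ι_apply, gradeGen, AddMonoidAlgebra.single_mul_single,
      eStar_mul_v]
    rfl
  | ck1 f g =>
    simp only [map_mul, apply_ite (FreeAlgebra.lift k (gradeGen (k := k))), map_zero,
      FreeAlgebra.lift_ι_apply, gradeGen, AddMonoidAlgebra.single_mul_single, eStar_mul_e]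
    split_ifs with h
    · subst h
      rfl
    · exact AddMonoidAlgebra.single_zero _
  | ck2 w hw =>
    simp only [map_sum, map_mul, FreeAlgebra.lift_ι_apply, gradeGen,
      AddMonoidAlgebra.single_mul_single]
    rw [hsum, ← ck2 k w hw]
    rfl

/-- The coaction `L_k(G) → L_k(G)[t, t⁻¹]`, which sends `x` of degree `n` to `xtⁿ`. -/
noncomputable def gradeHom : Leavitt k G →ₐ[k] AddMonoidAlgebra (Leavitt k G) ℤ :=
  RingQuot.liftAlgHom k ⟨FreeAlgebra.lift k gradeGen, fun _ _ h => lift_gradeGen_rel h⟩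

theorem gradeHom_mk (x : FreeGen k G) :
    gradeHom (mk k G x) = FreeAlgebra.lift k (gradeGen (k := k)) x :=
  RingQuot.liftAlgHom_mkAlgHom_apply k _ _ x

theorem gradeHom_v (w : G.V) : gradeHom (v k w) = .single 0 (v k w) :=
  (gradeHom_mk _).trans (FreeAlgebra.lift_ι_apply _ _)

theorem gradeHom_e (f : G.E) : gradeHom (e k f) = .single 1 (e k f) :=
  (gradeHom_mk _).trans (FreeAlgebra.lift_ι_apply _ _)

theorem gradeHom_eStar (f : G.E) : gradeHom (eStar k f) = .single (-1) (eStar k f) :=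
  (gradeHom_mk _).trans (FreeAlgebra.lift_ι_apply _ _)

theorem gradeHom_path {a b : G.V} (p : Quiver.Path a b) :
    gradeHom (path k p) = .single (p.length : ℤ) (path k p) := by
  induction p with
  | nil => exact gradeHom_v a
  | cons p f ih =>
    rw [path, map_mul, ih, gradeHom_e, AddMonoidAlgebra.single_mul_single]
    rfl

theorem gradeHom_pathStar {a b : G.V} (p : Quiver.Path a b) :
    gradeHom (pathStar k p) = .single (-p.length : ℤ) (pathStar k p) := by
  induction p with
  | nil => exact gradeHom_v a
  | cons p f ih =>
    rw [pathStar, map_mul, ih, gradeHom_eStar, AddMonoidAlgebra.single_mul_single,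
      Quiver.Path.length_cons]
    push_cast
    rw [neg_add_rev]

theorem gradeHom_apply {n : ℤ} {x : Leavitt k G} (hx : x ∈ grading k G n) :
    gradeHom x = .single n x := by
  change x ∈ Submodule.span k _ at hx
  induction hx using Submodule.span_induction with
  | mem x hx =>
    obtain ⟨a, b, d, α, β, rfl, rfl⟩ := hx
    rw [map_mul, gradeHom_path, gradeHom_pathStar, AddMonoidAlgebra.single_mul_single,
      sub_eq_add_neg]
  | zero => rw [map_zero, AddMonoidAlgebra.single_zero]
  | add x y _ _ hx hy => rw [map_add, hx, hy, AddMonoidAlgebra.single_add]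
  | smul c x _ hx => rw [map_smul, hx, AddMonoidAlgebra.smul_single]

/-- Taking the coefficient of tⁱ in the coaction is a projection in the sense of `of_proj`. No basis
of L_k(G) is needed. -/
theorem isInternal_grading : DirectSum.IsInternal (grading k G) := by
  refine InternalGrading.of_proj
    (fun i => AddMonoidHom.mk' (fun x => (gradeHom x).coeff i) fun x y => by
      rw [map_add, AddMonoidAlgebra.coeff_add, Finsupp.add_apply])
    (fun i j x hx => ?_) iSup_grading
  change (gradeHom x).coeff i = _
  rw [gradeHom_apply hx, AddMonoidAlgebra.coeff_single, Finsupp.single_apply]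

end

end FinGraph.Leavitt

/-! # Bimodules extended to the Leavitt path algebra -/

namespace FinGraph.Leavitt

variable {k : Type u} [Field k] {G : FinGraph.{u}}

/-- The underlying additive group of the bimodule `L_k(G)`. -/
noncomputable def toBim : Leavitt k G ≃+ bim k G := AddEquiv.refl (Leavitt k G)

/-- An additive map between modules over the Leavitt path algebra of a graph without sinks is linear
as soon as it commutes with scalars, vertices and edges. -/
theorem map_smul_of_generators (hG : G.NoSinks) {P Q : Type*} [AddCommGroup P] [AddCommGroup Q]
    [Module (Leavitt k G) P] [Module (Leavitt k G) Q] (F : P →+ Q)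
    (hk : ∀ (c : k) (y : P), F (algebraMap k (Leavitt k G) c • y) = algebraMap k (Leavitt k G) c • F y)
    (hv : ∀ (w : G.V) (y : P), F (v k w • y) = v k w • F y)
    (he : ∀ (f : G.E) (y : P), F (e k f • y) = e k f • F y) (x : Leavitt k G) (y : P) :
    F (x • y) = x • F y := by
  induction x using induction_on generalizing y with
  | hk c => exact hk c y
  | hv w => exact hv w y
  | he f => exact he f y
  | hs f =>
    -- Expanding y by ∑ gg* = 1 expresses F y through edges alone. Applying f* leaves only g = f,
    -- where f*f = r(f) is absorbed by f*.
    have h1 : y = ∑ g : G.E, e k g • eStar k g • y := by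
      simp only [smul_smul]
      rw [← Finset.sum_smul, sum_e_mul_eStar k hG, one_smul]
    have h2 : F y = ∑ g : G.E, e k g • F (eStar k g • y) := by
      conv_lhs => rw [h1]
      rw [map_sum]
      exact Finset.sum_congr rfl fun g _ => he g _
    rw [h2, Finset.smul_sum, Finset.sum_eq_single f]
    · rw [smul_smul, eStar_mul_e, if_pos rfl, ← hv, smul_smul, v_mul_eStar]
    · intro g _ hg
      rw [smul_smul, eStar_mul_e, if_neg hg.symm, zero_smul]
    · simp
  | hm x x' hx hx' => rw [mul_smul, mul_smul, hx, hx']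
  | ha x x' hx hx' => rw [add_smul, add_smul, map_add, hx, hx']

end FinGraph.Leavitt

namespace Bimodule

open FinGraph

section

variable {k : Type u} [Field k] {G : FinGraph.{u}} {S : Type u} [Ring S] [Algebra k S]
variable {Y : Bimodule k (VAlg k G) S} (τ : edgeBim k G ⊠ Y ≃ᵇ Y)

/-- The underlying additive group of `leavittExtend Y τ` is that of `Y`. -/
noncomputable def toExtend : Y ≃+ leavittExtend Y τ := AddEquiv.refl Y

theorem act_mk (x : FreeGen k G) : act τ (Leavitt.mk k G x) = actFree τ x :=
  let _ := kModule Y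
  have _ := kModule_smulCommClass Y
  have _ := kModule_isScalarTower Y
  RingQuot.liftAlgHom_mkAlgHom_apply k _ _ x

theorem act_mk_ι (g : G.Gen) : act τ (Leavitt.mk k G (FreeAlgebra.ι k g)) = actGen τ g :=
  let _ := kModule Y
  have _ := kModule_smulCommClass Y
  have _ := kModule_isScalarTower Y
  (act_mk τ _).trans (FreeAlgebra.lift_ι_apply _ _)

theorem algebraMap_smul_toExtend (c : k) (y : Y) :
    algebraMap k (Leavitt k G) c • toExtend τ y = toExtend τ (algebraMap k (VAlg k G) c • y) := by
  rw [(leavittExtend Y τ).central, Y.central]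
  rfl

theorem v_smul_toExtend (w : G.V) (y : Y) :
    Leavitt.v k w • toExtend τ y = toExtend τ (vert k G w • y) :=
  DFunLike.congr_fun (act_mk_ι τ (.vertex w)) y

theorem e_smul_toExtend (f : G.E) (y : Y) :
    Leavitt.e k f • toExtend τ y = toExtend τ (τ (tmul (edge k f) y)) :=
  DFunLike.congr_fun (act_mk_ι τ (.edge f)) y

theorem eStar_smul_toExtend (f : G.E) (y : Y) :
    Leavitt.eStar k f • toExtend τ y = toExtend τ (contract Y f (τ.symm y)) :=
  DFunLike.congr_fun (act_mk_ι τ (.ghost f)) y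

/-- The extension prescribes the action of single vertices; centrality of k shows that the whole
original action of kG⁰ is recovered. -/
theorem ofVAlg_smul_toExtend (a : VAlg k G) (y : Y) :
    Leavitt.ofVAlg k a • toExtend τ y = toExtend τ (a • y) := by
  have h : ∀ w, (a w • Leavitt.v k w) • toExtend τ y =
      toExtend τ ((algebraMap k (VAlg k G) (a w) * vert k G w) • y) := fun w => by
    rw [Algebra.smul_def, mul_smul, v_smul_toExtend, algebraMap_smul_toExtend, mul_smul]
  change (∑ w, a w • Leavitt.v k w) • toExtend τ y = _
  rw [Finset.sum_smul, Finset.sum_congr rfl fun w _ => h w, ← map_sum, ← Finset.sum_smul]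
  congr 2
  funext u
  simp [Finset.sum_apply, vert, Pi.single_apply]

theorem ofEdge_smul_toExtend (x : edgeBim k G) (y : Y) :
    Leavitt.ofEdge k x • toExtend τ y = toExtend τ (τ (tmul x y)) := by
  -- The coefficient at f is carried by the range vertex of f, from where it crosses the tensor
  -- sign.
  have h : ∀ f, (coeff x f • Leavitt.e k f) • toExtend τ y = toExtend τ
      (τ (tmul (op (Pi.single (G.rng f) (coeff x f) : VAlg k G) • edge k f) y)) := fun f => by
    rw [tmul_balanced, ← e_smul_toExtend, ← ofVAlg_smul_toExtend, smul_smul, Leavitt.ofVAlg_single,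
      mul_smul_comm, Leavitt.e_mul_v]
  rw [Leavitt.ofEdge_apply, Finset.sum_smul, Finset.sum_congr rfl fun f _ => h f, ← map_sum,
    ← τ.apply_sum, ← sum_tmul, ← edge_expand]

theorem toExtend_symm_ofEdge_mul_smul (x : edgeBim k G) (a : Leavitt k G) (y : leavittExtend Y τ) :
    (toExtend τ).symm ((Leavitt.ofEdge k x * a) • y) =
      τ (tmul x ((toExtend τ).symm (a • y))) := by
  rw [AddEquiv.symm_apply_eq, ← ofEdge_smul_toExtend, AddEquiv.apply_symm_apply, mul_smul]

theorem rsmul_toExtend (s : Sᵐᵒᵖ) (y : Y) : s • toExtend τ y = toExtend τ (s • y) := rfl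

/-- The action map `L_k(G) ⊗ Y → Y`. -/
noncomputable def extendUnitorHom :
    (Leavitt.bim k G ⊠ leavittExtend Y τ : Bimodule k (VAlg k G) S) →+ Y :=
  tensorLift (fun x y => (toExtend τ).symm ((Leavitt.toBim.symm x : Leavitt k G) • y))
    (fun x x' y => by rw [map_add, add_smul, map_add])
    (fun x y y' => by rw [smul_add, map_add])
    (fun x b y => by
      rw [smul_smul]
      rfl)

theorem extendUnitorHom_tmul (x : Leavitt k G) (y : leavittExtend Y τ) :
    extendUnitorHom τ (tmul (Leavitt.toBim x) y) = (toExtend τ).symm (x • y) := rfl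

/-- The isomorphism `L_k(G) ⊗ Y ≅ Y`. -/
noncomputable def extendUnitor : Leavitt.bim k G ⊠ leavittExtend Y τ ≃ᵇ Y where
  toFun := extendUnitorHom τ
  invFun y := tmul (Leavitt.toBim (1 : Leavitt k G)) (toExtend τ y)
  left_inv := tensor_hom_ext
    (F := (AddMonoidHom.mk' (fun y => (tmul (Leavitt.toBim (1 : Leavitt k G)) (toExtend τ y) :
      (Leavitt.bim k G ⊠ leavittExtend Y τ :))) (fun y y' => tmul_add _ (toExtend τ y) _)).comp
        (extendUnitorHom τ))
    (G := AddMonoidHom.id _) fun x y =>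
      (tmul_balanced (Leavitt.toBim.symm x) (Leavitt.toBim (1 : Leavitt k G)) y).symm.trans
        (congrArg (fun t => tmul (Leavitt.toBim t) y) (one_mul (Leavitt.toBim.symm x)))
  right_inv y := congrArg (toExtend τ).symm (one_smul (Leavitt k G) (toExtend τ y))
  map_add' := map_add _
  map_lsmul := tensor_map_lsmul _ fun a x y => by
    obtain ⟨x, rfl⟩ := Leavitt.toBim.surjective x
    change (toExtend τ).symm ((Leavitt.ofVAlg k a * x) • y) = a • (toExtend τ).symm (x • y)
    rw [AddEquiv.symm_apply_eq, ← ofVAlg_smul_toExtend, AddEquiv.apply_symm_apply, mul_smul]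
  map_rsmul := tensor_map_rsmul _ fun s x y => by
    obtain ⟨x, rfl⟩ := Leavitt.toBim.surjective x
    rw [extendUnitorHom_tmul, extendUnitorHom_tmul, AddEquiv.symm_apply_eq, ← rsmul_toExtend,
      AddEquiv.apply_symm_apply, smul_comm]

end

end Bimodule

/-! # The composite of two bridging bimodules -/

namespace Bimodule

open FinGraph

section

variable {k : Type u} [Field k] {E F G : FinGraph.{u}}

theorem tensor_bim_induction {A : Type u} [Ring A] [Algebra k A] {X : Bimodule k A (VAlg k G)}
    {p : (X ⊠ Leavitt.bim k G : Bimodule k A (Leavitt k G)) → Prop}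
    (ht : ∀ (x : X) (S : Leavitt k G), p (tmul x (Leavitt.toBim S)))
    (ha : ∀ z w, p z → p w → p (z + w)) (z : (X ⊠ Leavitt.bim k G : Bimodule k A (Leavitt k G))) :
    p z :=
  tensor_induction (by simpa only [zero_tmul] using ht 0 0)
    (fun x y => by simpa only [AddEquiv.apply_symm_apply] using ht x (Leavitt.toBim.symm y)) ha z

section Absorb

variable {A : Type u} [Ring A] [Algebra k A] (hG : G.NoSinks) (X : Bimodule k A (VAlg k G))

/-- The isomorphism `(X ⊗ kG¹) ⊗ L_k(G) ≅ X ⊗ L_k(G)`, `(x ⊗ y) ⊗ S ↦ x ⊗ yS`. -/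
noncomputable def absorb : (X ⊠ edgeBim k G) ⊠ Leavitt.bim k G ≃ᵇ X ⊠ Leavitt.bim k G :=
  (assoc X (edgeBim k G) (Leavitt.bim k G)).trans (tensorCongr (Equiv.refl X) (rho k hG))

theorem absorb_tmul (x : X) (y : edgeBim k G) (S : Leavitt k G) :
    absorb hG X (tmul (tmul x y) (Leavitt.toBim S)) =
      tmul x (Leavitt.toBim (Leavitt.ofEdge k y * S)) := rfl

end Absorb

/-! ### Multiplication by tensor powers of kG¹ -/

section Power

variable (hG : G.NoSinks)

/-- The inductive step of `powMul_nuSucc`, for abstract `μ` and `ν`: on a pure tensor z ⊗ y it is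
the hypothesis for z with S replaced by yS. -/
theorem absorb_assoc_symm {X : Bimodule k (VAlg k G) (VAlg k G)}
    {μ : X ⊠ Leavitt.bim k G ≃ᵇ Leavitt.bim k G} {ν : edgeBim k G ⊠ X ≃ᵇ X ⊠ edgeBim k G}
    (h : ∀ (x : edgeBim k G) (z : X) (S : Leavitt k G),
      μ (absorb hG X (tmul (ν (tmul x z)) (Leavitt.toBim S))) =
        Leavitt.toBim (Leavitt.ofEdge k x * Leavitt.toBim.symm (μ (tmul z (Leavitt.toBim S)))))
    (x : edgeBim k G) (z : (X ⊠ edgeBim k G :)) (S : Leavitt k G) :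
    μ (absorb hG X (absorb hG (X ⊠ edgeBim k G) (tmul (tensorCongr ν (Equiv.refl (edgeBim k G))
      ((assoc (edgeBim k G) X (edgeBim k G)).symm (tmul x z))) (Leavitt.toBim S)))) =
        Leavitt.toBim (Leavitt.ofEdge k x *
          Leavitt.toBim.symm (μ (absorb hG X (tmul z (Leavitt.toBim S))))) := by
  induction z using tensor_induction with
  | h0 => simp only [tmul_zero, zero_tmul, Equiv.apply_zero, map_zero, mul_zero]
  | ht z y => exact h x z (Leavitt.ofEdge k y * S)
  | ha z z' hz hz' => simp only [tmul_add, add_tmul, Equiv.apply_add, map_add, mul_add, hz, hz']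

theorem absorb_mem {X : Bimodule k (VAlg k G) (VAlg k G)}
    {μ : X ⊠ Leavitt.bim k G ≃ᵇ Leavitt.bim k G} {d : ℤ}
    (h : ∀ (z : X) {S : Leavitt k G} {i : ℤ}, S ∈ Leavitt.grading k G i →
      Leavitt.toBim.symm (μ (tmul z (Leavitt.toBim S))) ∈ Leavitt.grading k G (d + i))
    (z : (X ⊠ edgeBim k G :)) {S : Leavitt k G} {i : ℤ} (hS : S ∈ Leavitt.grading k G i) :
    Leavitt.toBim.symm (μ (absorb hG X (tmul z (Leavitt.toBim S)))) ∈
      Leavitt.grading k G (d + 1 + i) := by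
  induction z using tensor_induction with
  | h0 =>
    rw [zero_tmul, Equiv.apply_zero, Equiv.apply_zero, map_zero]
    exact zero_mem _
  | ht z y =>
    rw [add_assoc]
    exact h z (Leavitt.mul_mem (Leavitt.ofEdge_mem y) hS)
  | ha z z' hz hz' =>
    rw [add_tmul, Equiv.apply_add, Equiv.apply_add, map_add]
    exact add_mem hz hz'

variable (k) in
/-- The multiplication `(kG¹)^{⊗(m+1)} ⊗ L_k(G) ≅ L_k(G)`. -/
noncomputable def powMul : (m : ℕ) → (edgePowSucc k G m ⊠ Leavitt.bim k G ≃ᵇ Leavitt.bim k G)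
  | 0 => rho k hG
  | m + 1 => (absorb hG (edgePowSucc k G m)).trans (powMul m)

/-- Multiplying out forgets the bracketing, and ν only moves a bracket: both sides are the product
of x, the factors of z, and S. -/
theorem powMul_nuSucc (m : ℕ) (x : edgeBim k G) (z : edgePowSucc k G m) (S : Leavitt k G) :
    powMul k hG m (absorb hG _ (tmul (nuSucc k G m (tmul x z)) (Leavitt.toBim S))) =
      Leavitt.toBim (Leavitt.ofEdge k x *
        Leavitt.toBim.symm (powMul k hG m (tmul z (Leavitt.toBim S)))) := by
  induction m generalizing x S with
  | zero => rfl
  | succ m ih => exact absorb_assoc_symm hG (fun x z S => ih x z S) x z S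

/-- The index `m` stands for the power m + 1, and each factor contributes degree one. -/
theorem powMul_mem (m : ℕ) (z : edgePowSucc k G m) {S : Leavitt k G} {i : ℤ}
    (hS : S ∈ Leavitt.grading k G i) :
    Leavitt.toBim.symm (powMul k hG m (tmul z (Leavitt.toBim S))) ∈
      Leavitt.grading k G (m + 1 + i) := by
  induction m generalizing S i with
  | zero =>
    rw [Nat.cast_zero, zero_add]
    exact Leavitt.mul_mem (Leavitt.ofEdge_mem z) hS
  | succ m ih =>
    push_cast
    exact absorb_mem hG (fun z _ _ hS => ih z hS) z hS

end Power

section Bridge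

variable (hF : F.NoSinks) (M : Bimodule k (VAlg k E) (VAlg k F))

variable {M}
variable (σ : edgeBim k E ⊠ M ≃ᵇ M ⊠ edgeBim k F)

theorem bridgeIso_tmul (x : edgeBim k E) (m : M) (S : Leavitt k F) :
    bridgeIso hF M σ (tmul x (tmul m (Leavitt.toBim S))) =
      absorb hF M (tmul (σ (tmul x m)) (Leavitt.toBim S)) := rfl

/-- Multiplication kF¹ ⊗ L_k(F) → L_k(F) is undone by S ↦ ∑ f ⊗ f*S, after which σ⁻¹ acts on each m
⊗ f. This exposes the degree of the ghost action. -/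
theorem bridgeIso_symm_tmul (m : M) (S : Leavitt k F) :
    (bridgeIso hF M σ).symm (tmul m (Leavitt.toBim S)) =
      ∑ f : F.E, assoc (edgeBim k E) M (Leavitt.bim k F)
        (tmul (σ.symm (tmul m (edge k f))) (Leavitt.toBim (Leavitt.eStar k f * S))) := by
  have h : (bridgeIso hF M σ).symm (tmul m (Leavitt.toBim S)) =
      assoc (edgeBim k E) M (Leavitt.bim k F) ((tensorCongr σ (Equiv.refl _)).symm
        ((assoc M (edgeBim k F) (Leavitt.bim k F)).symm (tmul m (rhoInv k F S)))) := rfl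
  rw [h, rhoInv, tmul_sum, Equiv.apply_sum, Equiv.apply_sum, Equiv.apply_sum]
  rfl

end Bridge

/-! ### Left linearity of the composite isomorphism -/

section Composite

variable (hE : E.NoSinks) (hF : F.NoSinks) {M : Bimodule k (VAlg k E) (VAlg k F)}
  {N : Bimodule k (VAlg k F) (VAlg k E)} {n : ℕ} (ω : M ⊠ N ≃ᵇ edgePowSucc k E n)
  (σM : edgeBim k E ⊠ M ≃ᵇ M ⊠ edgeBim k F) (σN : edgeBim k F ⊠ N ≃ᵇ N ⊠ edgeBim k E)

/-- The isomorphism `M ⊗ (N ⊗ L_k(E)) ≅ L_k(E)` induced by `ω : M ⊗ N ≅ (kE¹)^{⊗(n+1)}`. -/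
noncomputable def evalEquiv : M ⊠ (N ⊠ Leavitt.bim k E) ≃ᵇ Leavitt.bim k E :=
  (assoc M N (Leavitt.bim k E)).symm.trans <|
    (tensorCongr ω (Equiv.refl _)).trans (powMul k hE n)

theorem evalEquiv_tmul (m : M) (x : N) (S : Leavitt k E) :
    evalEquiv hE ω (tmul m (tmul x (Leavitt.toBim S))) =
      powMul k hE n (tmul (ω (tmul m x)) (Leavitt.toBim S)) := rfl

/-- The isomorphism `Y_{(M,σ)} ⊗ Y_{(N,ψ)} ≅ M ⊗ Y_{(N,ψ)} ≅ L_k(E)` of `kE⁰`-`L_k(E)`-bimodules. -/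
noncomputable def compositeEquiv :
    (M ⊠ Leavitt.bim k F) ⊠ bridging hE N σN ≃ᵇ Leavitt.bim k E :=
  (assoc M (Leavitt.bim k F) (bridging hE N σN)).trans <|
    (tensorCongr (Equiv.refl M) (extendUnitor (bridgeIso hE N σN))).trans (evalEquiv hE ω)

theorem compositeEquiv_tmul (m : M) (S : Leavitt k F) (x : bridging hE N σN) :
    compositeEquiv hE ω σN (tmul (tmul m (Leavitt.toBim S)) x) =
      evalEquiv hE ω (tmul m ((toExtend (bridgeIso hE N σN)).symm (S • x))) := rfl

/-- The tensor product is over L_k(F), so an edge of F absorbed into S can be moved across to Y_N,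
where it acts through σ_N. This is how σ_N comes to follow σ_M. -/
theorem compositeEquiv_absorb (u : (M ⊠ edgeBim k F :)) (S : Leavitt k F) (x : bridging hE N σN) :
    compositeEquiv hE ω σN (tmul (absorb hF M (tmul u (Leavitt.toBim S))) x) =
      evalEquiv hE ω (tensorCongr (Equiv.refl M) (bridgeIso hE N σN)
        (assoc M (edgeBim k F) (N ⊠ Leavitt.bim k E)
          (tmul u ((toExtend (bridgeIso hE N σN)).symm (S • x))))) := by
  induction u using tensor_induction with
  | h0 => simp only [zero_tmul, Equiv.apply_zero]
  | ht m y =>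
    rw [absorb_tmul, compositeEquiv_tmul]
    change _ = evalEquiv hE ω (tmul m (bridgeIso hE N σN
      (tmul y ((toExtend (bridgeIso hE N σN)).symm (S • x)))))
    exact congrArg (fun t => evalEquiv hE ω (tmul m t))
      (toExtend_symm_ofEdge_mul_smul (bridgeIso hE N σN) y S x)
  | ha u u' hu hu' => simp only [add_tmul, Equiv.apply_add, hu, hu']

/-- The left side absorbs the edge produced by σ_N before applying ω, the right side after it; the
two operations touch different factors. -/
theorem evalEquiv_bridgeIso (u : (M ⊠ edgeBim k F :)) (x : N) (S : Leavitt k E) :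
    evalEquiv hE ω (tensorCongr (Equiv.refl M) (bridgeIso hE N σN)
        (assoc M (edgeBim k F) (N ⊠ Leavitt.bim k E) (tmul u (tmul x (Leavitt.toBim S))))) =
      powMul k hE n (absorb hE _ (tmul (tensorCongr ω (Equiv.refl (edgeBim k E))
        ((assoc M N (edgeBim k E)).symm (tensorCongr (Equiv.refl M) σN
          (assoc M (edgeBim k F) N (tmul u x))))) (Leavitt.toBim S))) := by
  induction u using tensor_induction with
  | h0 => simp only [zero_tmul, Equiv.apply_zero]
  | ht m y =>
    change evalEquiv hE ω (tmul m (absorb hE N (tmul (σN (tmul y x)) (Leavitt.toBim S)))) =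
      powMul k hE n (absorb hE _ (tmul (tensorCongr ω (Equiv.refl (edgeBim k E))
        ((assoc M N (edgeBim k E)).symm (tmul m (σN (tmul y x))))) (Leavitt.toBim S)))
    -- The image under σ_N is an arbitrary element of N ⊗ kE¹, but the identity is additive in it,
    -- which leaves pure tensors.
    generalize σN (tmul y x) = w
    induction w using tensor_induction with
    | h0 => simp only [zero_tmul, tmul_zero, Equiv.apply_zero]
    | ht x' z => rfl
    | ha w w' hw hw' => simp only [add_tmul, tmul_add, Equiv.apply_add, hw, hw']
  | ha u u' hu hu' => simp only [add_tmul, Equiv.apply_add, hu, hu']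

/-- The only use of the intertwining hypothesis. Acting by an edge of E amounts to σ_M # σ_N
followed by ω and multiplication; `hω` replaces this by ω followed by ν, and `powMul_nuSucc`
identifies the result as a left multiplication. -/
theorem compositeEquiv_bridgeIso
    (hω : ∀ z : (edgeBim k E ⊠ (M ⊠ N) : Bimodule k (VAlg k E) (VAlg k E)),
      nuSucc k E n (tensorCongr (Equiv.refl (edgeBim k E)) ω z) =
        tensorCongr ω (Equiv.refl (edgeBim k E)) (hashIso σM σN z))
    (a : edgeBim k E) (y : (M ⊠ Leavitt.bim k F :)) (x : bridging hE N σN) :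
    compositeEquiv hE ω σN (tmul (bridgeIso hF M σM (tmul a y)) x) =
      Leavitt.toBim (Leavitt.ofEdge k a *
        Leavitt.toBim.symm (compositeEquiv hE ω σN (tmul y x))) := by
  induction y using tensor_bim_induction with
  | ht m S =>
    rw [bridgeIso_tmul, compositeEquiv_absorb, compositeEquiv_tmul]
    -- S • x has no closed form, but only its being an element of N ⊗ L_k(E) matters.
    generalize (toExtend (bridgeIso hE N σN)).symm (S • x) = w
    induction w using tensor_bim_induction with
    | ht x' T =>
      rw [evalEquiv_bridgeIso, evalEquiv_tmul, ← powMul_nuSucc]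
      exact congrArg (fun t => powMul k hE n (absorb hE _ (tmul t (Leavitt.toBim T))))
        (hω (tmul a (tmul m x'))).symm
    | ha w w' hw hw' => simp only [tmul_add, Equiv.apply_add, map_add, mul_add, hw, hw']
  | ha y y' hy hy' => simp only [tmul_add, add_tmul, Equiv.apply_add, map_add, mul_add, hy, hy']

/-- The isomorphism `Y_{(M,σ)} ⊗ Y_{(N,ψ)} ≅ L_k(E)` of `L_k(E)`-bimodules. -/
noncomputable def bridgingComposite
    (hω : ∀ z : (edgeBim k E ⊠ (M ⊠ N) : Bimodule k (VAlg k E) (VAlg k E)),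
      nuSucc k E n (tensorCongr (Equiv.refl (edgeBim k E)) ω z) =
        tensorCongr ω (Equiv.refl (edgeBim k E)) (hashIso σM σN z)) :
    bridging hF M σM ⊠ bridging hE N σN ≃ᵇ regular k (Leavitt k E) where
  __ := (compositeEquiv hE ω σN).toAddEquiv
  map_rsmul := (compositeEquiv hE ω σN).map_rsmul
  map_lsmul a z := by
    let Φ : (bridging hF M σM ⊠ bridging hE N σN : Bimodule k _ _) →+ Leavitt k E :=
      (compositeEquiv hE ω σN).toAddEquiv.toAddMonoidHom
    have ext : ∀ a : Leavitt k E, (∀ y x, Φ (tmul (a • toExtend (bridgeIso hF M σM) y) x) =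
        a * Φ (tmul (toExtend (bridgeIso hF M σM) y) x)) → ∀ z, Φ (a • z) = a • Φ z :=
      fun a h z => tensor_hom_ext (F := Φ.comp (DistribSMul.toAddMonoidHom _ a))
        (G := (AddMonoidHom.mulLeft a).comp Φ) (fun y x => h y x) z
    have hV : ∀ (b : VAlg k E) (y : (M ⊠ Leavitt.bim k F :)) (x : bridging hE N σN),
        Φ (tmul (toExtend (bridgeIso hF M σM) (b • y)) x) =
          Leavitt.ofVAlg k b * Φ (tmul (toExtend (bridgeIso hF M σM) y) x) := fun b y x =>
      (compositeEquiv hE ω σN).map_lsmul b (tmul y x)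
    -- Scalars and vertices come from kE⁰-linearity and edges from the intertwining hypothesis;
    -- ghost edges need no separate check.
    refine Leavitt.map_smul_of_generators hE Φ (fun c => ext _ fun y x => ?_)
      (fun w => ext _ fun y x => ?_) (fun f => ext _ fun y x => ?_) a z
    · rw [algebraMap_smul_toExtend, hV, AlgHom.commutes]
    · rw [v_smul_toExtend, hV, Leavitt.ofVAlg_vert]
    · rw [e_smul_toExtend, ← Leavitt.ofEdge_edge]
      exact compositeEquiv_bridgeIso hE hF ω σM σN hω (edge k f) y x

end Composite

end

end Bimodule

/-! # The grading of the bridging bimodule -/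

namespace Bimodule

open FinGraph

section

variable {k : Type u} [Field k] {E F : FinGraph.{u}}

/-- kF⁰ lies in degree 0, so the projections of L_k(F) are left kF⁰-linear and can be tensored with
M. -/
theorem proj_ofVAlg_mul (i : ℤ) (a : VAlg k F) (S : Leavitt k F) :
    InternalGrading.proj Leavitt.isInternal_grading i (Leavitt.ofVAlg k a * S) =
      Leavitt.ofVAlg k a * InternalGrading.proj Leavitt.isInternal_grading i S := by
  have ha : Leavitt.ofVAlg k a ∈ Leavitt.grading k F 0 :=
    sum_mem fun w _ => Leavitt.smul_mem_grading _ (Leavitt.v_mem w)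
  induction S using InternalGrading.induction Leavitt.iSup_grading with
  | hom j S hS =>
    have h := Leavitt.mul_mem ha hS
    rw [zero_add] at h
    rw [InternalGrading.proj_apply _ i hS, InternalGrading.proj_apply _ i h]
    split_ifs
    · rfl
    · exact (mul_zero _).symm
  | add S T hS hT => rw [mul_add, map_add, map_add, mul_add, hS, hT]

/-- The component of degree `i` of `M ⊗ L_k(F)`, for `M` in degree `d`. -/
noncomputable def bimGr (M : Bimodule k (VAlg k E) (VAlg k F)) (d i : ℤ) :
    AddSubgroup (M ⊠ Leavitt.bim k F : Bimodule k (VAlg k E) (Leavitt k F)) :=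
  AddSubgroup.closure {z | ∃ (m : M) (S : Leavitt k F), S ∈ Leavitt.grading k F (i - d) ∧
    z = tmul m (Leavitt.toBim S)}

variable {M : Bimodule k (VAlg k E) (VAlg k F)}

theorem tmul_mem_bimGr {d i : ℤ} (m : M) {S : Leavitt k F}
    (hS : S ∈ Leavitt.grading k F (i - d)) : tmul m (Leavitt.toBim S) ∈ bimGr M d i :=
  AddSubgroup.subset_closure ⟨m, S, hS, rfl⟩

theorem bimGr_le_comap {P : Type*} [AddCommGroup P] {B : AddSubgroup P} {d i : ℤ}
    (Φ : (M ⊠ Leavitt.bim k F : Bimodule k (VAlg k E) (Leavitt k F)) →+ P)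
    (h : ∀ (m : M) (S : Leavitt k F), S ∈ Leavitt.grading k F (i - d) →
      Φ (tmul m (Leavitt.toBim S)) ∈ B) {z : (M ⊠ Leavitt.bim k F :)} (hz : z ∈ bimGr M d i) :
    Φ z ∈ B := by
  suffices h' : bimGr M d i ≤ B.comap Φ from h' hz
  refine (AddSubgroup.closure_le _).mpr ?_
  rintro _ ⟨m, S, hS, rfl⟩
  exact h m S hS

/-- The projection of `M ⊗ L_k(F)` onto its component of degree `i + d`, for `M` in degree `d`. -/
noncomputable def bimProj (M : Bimodule k (VAlg k E) (VAlg k F)) (i : ℤ) :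
    (M ⊠ Leavitt.bim k F : Bimodule k (VAlg k E) (Leavitt k F)) →+
      (M ⊠ Leavitt.bim k F : Bimodule k (VAlg k E) (Leavitt k F)) :=
  tensorLift (fun m S => tmul m (Leavitt.toBim
      (InternalGrading.proj Leavitt.isInternal_grading i (Leavitt.toBim.symm S))))
    (fun m m' S => add_tmul m m' _)
    (fun m S S' => by rw [map_add, map_add, map_add, tmul_add])
    (fun m a S => by
      rw [tmul_balanced]
      exact congrArg (fun t => tmul m (Leavitt.toBim t))
        (proj_ofVAlg_mul i a (Leavitt.toBim.symm S)).symm)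

theorem isInternal_bimGr (M : Bimodule k (VAlg k E) (VAlg k F)) (d : ℤ) :
    DirectSum.IsInternal (bimGr M d) := by
  refine InternalGrading.of_proj (fun i => bimProj M (i - d)) (fun i j z hz => ?_) ?_
  · have key : ∀ (m : M) (S : Leavitt k F), S ∈ Leavitt.grading k F (j - d) →
        bimProj M (i - d) (tmul m (Leavitt.toBim S)) =
          if j = i then tmul m (Leavitt.toBim S) else 0 := by
      intro m S hS
      change tmul m (Leavitt.toBim (InternalGrading.proj _ (i - d) S)) = _
      rw [InternalGrading.proj_apply _ _ hS]
      simp only [sub_left_inj]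
      split_ifs
      · rfl
      · rw [map_zero, tmul_zero]
    -- Each case says that an additive map vanishes on the component, that is, takes values in `⊥`
    -- there; it therefore suffices to test generators.
    split_ifs with hij
    · simp only [if_pos hij] at key
      exact sub_eq_zero.mp (bimGr_le_comap (B := ⊥) (bimProj M (i - d) - AddMonoidHom.id _)
        (fun m S hS => sub_eq_zero.mpr (key m S hS)) hz)
    · simp only [if_neg hij] at key
      exact bimGr_le_comap (B := ⊥) (bimProj M (i - d)) key hz
  · rw [eq_top_iff]
    intro z _
    induction z using tensor_bim_induction with
    | ht m S =>
      induction S using InternalGrading.induction Leavitt.iSup_grading with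
      | hom j S hS =>
        refine AddSubgroup.mem_iSup_of_mem (j + d) (tmul_mem_bimGr m ?_)
        rwa [add_sub_cancel_right]
      | add S T hS hT =>
        rw [map_add, tmul_add]
        exact add_mem (hS trivial) (hT trivial)
    | ha z w hz hw => exact add_mem (hz trivial) (hw trivial)

theorem lsmul_mem_bimGr {d i : ℤ} (a : VAlg k E) {z : (M ⊠ Leavitt.bim k F :)}
    (hz : z ∈ bimGr M d i) : a • z ∈ bimGr M d i :=
  bimGr_le_comap (DistribSMul.toAddMonoidHom (M ⊠ Leavitt.bim k F :) a) (fun m _ hS => tmul_mem_bimGr (a • m) hS) hz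

variable (hF : F.NoSinks) (σ : edgeBim k E ⊠ M ≃ᵇ M ⊠ edgeBim k F)

/-- σ exchanges an edge of E for an edge of F while M stays in degree `d`; absorbing the new edge
raises the degree of S by one. -/
theorem bridgeIso_mem {d i : ℤ} (x : edgeBim k E) {z : (M ⊠ Leavitt.bim k F :)}
    (hz : z ∈ bimGr M d i) : bridgeIso hF M σ (tmul x z) ∈ bimGr M d (1 + i) := by
  refine bimGr_le_comap (AddMonoidHom.mk' (fun z => bridgeIso hF M σ (tmul x z))
    fun z w => by rw [tmul_add, Equiv.apply_add]) (fun m S hS => ?_) hz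
  change bridgeIso hF M σ (tmul x (tmul m (Leavitt.toBim S))) ∈ bimGr M d (1 + i)
  rw [bridgeIso_tmul]
  generalize σ (tmul x m) = u
  induction u using tensor_induction with
  | h0 =>
    rw [zero_tmul, Equiv.apply_zero]
    exact zero_mem _
  | ht m y =>
    rw [absorb_tmul]
    refine tmul_mem_bimGr m ?_
    rw [add_sub_assoc]
    exact Leavitt.mul_mem (Leavitt.ofEdge_mem y) hS
  | ha u u' hu hu' =>
    rw [add_tmul, Equiv.apply_add]
    exact add_mem hu hu'

/-- The inverse replaces S by terms g*S, of degree one less; σ⁻¹ and the contraction affect only the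
factor in M. -/
theorem contract_bridgeIso_symm_mem {d i : ℤ} (f : E.E) {z : (M ⊠ Leavitt.bim k F :)}
    (hz : z ∈ bimGr M d i) :
    contract (M ⊠ Leavitt.bim k F) f ((bridgeIso hF M σ).symm z) ∈ bimGr M d (-1 + i) := by
  refine bimGr_le_comap (AddMonoidHom.mk'
    (fun z => contract (M ⊠ Leavitt.bim k F) f ((bridgeIso hF M σ).symm z))
    fun z w => by rw [Equiv.apply_add, map_add]) (fun m S hS => ?_) hz
  change contract (M ⊠ Leavitt.bim k F) f
    ((bridgeIso hF M σ).symm (tmul m (Leavitt.toBim S))) ∈ bimGr M d (-1 + i)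
  rw [bridgeIso_symm_tmul, map_sum]
  refine sum_mem fun g _ => ?_
  generalize σ.symm (tmul m (edge k g)) = u
  induction u using tensor_induction with
  | h0 =>
    rw [zero_tmul, Equiv.apply_zero, map_zero]
    exact zero_mem _
  | ht x m' =>
    refine tmul_mem_bimGr ((Pi.single (E.rng f) (coeff x f) : VAlg k E) • m') ?_
    rw [add_sub_assoc]
    exact Leavitt.eStar_mul_mem g hS
  | ha u u' hu hu' =>
    rw [add_tmul, Equiv.apply_add, map_add]
    exact add_mem hu hu'

/-- The grading of the bridging bimodule `Y_{(M,σ)}` in which `M` has degree `d`. -/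
noncomputable def bridgingGrading (d : ℤ) :
    Grading (Leavitt.grading k E) (Leavitt.grading k F) (bridging hF M σ) where
  gr := bimGr M d
  isInternal := isInternal_bimGr M d
  lsmul_mem {i j a y} ha hy :=
    Leavitt.smul_mem_of_generators (P := bridging hF M σ) (gr := bimGr M d)
      (fun c j y hy => by
        have h := algebraMap_smul_toExtend (bridgeIso hF M σ) c y
        exact h.symm ▸ lsmul_mem_bimGr _ hy)
      (fun w j y hy => by
        have h := v_smul_toExtend (bridgeIso hF M σ) w y
        exact h.symm ▸ lsmul_mem_bimGr _ hy)
      (fun f j y hy => by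
        have h := e_smul_toExtend (bridgeIso hF M σ) f y
        exact h.symm ▸ bridgeIso_mem hF σ _ hy)
      (fun f j y hy => by
        have h := eStar_smul_toExtend (bridgeIso hF M σ) f y
        exact h.symm ▸ contract_bridgeIso_symm_mem hF σ f hy) ha hy
  rsmul_mem {i j y s} hy hs :=
    bimGr_le_comap (DistribSMul.toAddMonoidHom (M ⊠ Leavitt.bim k F :) (op s)) (fun m S hS => by
      refine tmul_mem_bimGr (S := S * s) m ?_
      rw [add_sub_right_comm]
      exact Leavitt.mul_mem hS hs) hy

/-- For y = m ⊗ S the element S • x has degree a - c + b, so its L_k(E)-factors T have degree a - c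
+ b - d. Multiplication by ω(m ⊗ m'), a combination of products of n + 1 edges, restores c + d. -/
theorem bridgingComposite_mem (hE : E.NoSinks) {N : Bimodule k (VAlg k F) (VAlg k E)} {n : ℕ}
    (ω : M ⊠ N ≃ᵇ edgePowSucc k E n) (σM : edgeBim k E ⊠ M ≃ᵇ M ⊠ edgeBim k F)
    (σN : edgeBim k F ⊠ N ≃ᵇ N ⊠ edgeBim k E)
    (hω : ∀ z : (edgeBim k E ⊠ (M ⊠ N) : Bimodule k (VAlg k E) (VAlg k E)),
      nuSucc k E n (tensorCongr (Equiv.refl (edgeBim k E)) ω z) =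
        tensorCongr ω (Equiv.refl (edgeBim k E)) (hashIso σM σN z))
    {c d : ℤ} (hcd : c + d = n + 1) {a b : ℤ} {y : bridging hF M σM} {x : bridging hE N σN}
    (hy : y ∈ (bridgingGrading hF σM c).gr a) (hx : x ∈ (bridgingGrading hE σN d).gr b) :
    regularVal (bridgingComposite hE hF ω σM σN hω (tmul y x)) ∈
      Leavitt.grading k E (a + b) := by
  have hy' : (toExtend (bridgeIso hF M σM)).symm y ∈ bimGr M c a := hy
  refine bimGr_le_comap (AddMonoidHom.mk' (fun y : (M ⊠ Leavitt.bim k F :) => Leavitt.toBim.symm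
    (compositeEquiv hE ω σN (tmul y x)))
      fun y y' => by rw [add_tmul, Equiv.apply_add, map_add]) (fun m S hS => ?_) hy'
  have hSx : (toExtend (bridgeIso hE N σN)).symm (S • x) ∈ bimGr N d (a - c + b) :=
    (bridgingGrading hE σN d).lsmul_mem hS hx
  refine bimGr_le_comap (AddMonoidHom.mk' (fun w : (N ⊠ Leavitt.bim k E :) => Leavitt.toBim.symm
    (evalEquiv hE ω (tmul m w)))
      fun w w' => by rw [tmul_add, Equiv.apply_add, map_add]) (fun m' T hT => ?_) hSx
  have h := powMul_mem hE n (ω (tmul m m')) hT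
  rwa [show (n : ℤ) + 1 + (a - c + b - d) = a + b by linarith] at h

end

end Bimodule

theorem theorem6p4 (k : Type u) [Field k] (E F : FinGraph.{u}) (hE : E.NoSinks) (hF : F.NoSinks)
    (M : Bimodule k (FinGraph.VAlg k E) (FinGraph.VAlg k F))
    (N : Bimodule k (FinGraph.VAlg k F) (FinGraph.VAlg k E)) (n : ℕ+)
    (ωE : M ⊠ N ≃ᵇ Bimodule.edgePow k E n) (ωF : N ⊠ M ≃ᵇ Bimodule.edgePow k F n)
    (σM : FinGraph.edgeBim k E ⊠ M ≃ᵇ M ⊠ FinGraph.edgeBim k F)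
    (σN : FinGraph.edgeBim k F ⊠ N ≃ᵇ N ⊠ FinGraph.edgeBim k E)
    (hωE : ∀ z : (FinGraph.edgeBim k E ⊠ (M ⊠ N) :
        Bimodule k (FinGraph.VAlg k E) (FinGraph.VAlg k E)),
      Bimodule.nu k E n (Bimodule.tensorCongr (Bimodule.Equiv.refl (FinGraph.edgeBim k E)) ωE z) =
        Bimodule.tensorCongr ωE (Bimodule.Equiv.refl (FinGraph.edgeBim k E))
          (Bimodule.hashIso σM σN z))
    (hωF : ∀ z : (FinGraph.edgeBim k F ⊠ (N ⊠ M) :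
        Bimodule k (FinGraph.VAlg k F) (FinGraph.VAlg k F)),
      Bimodule.nu k F n (Bimodule.tensorCongr (Bimodule.Equiv.refl (FinGraph.edgeBim k F)) ωF z) =
        Bimodule.tensorCongr ωF (Bimodule.Equiv.refl (FinGraph.edgeBim k F))
          (Bimodule.hashIso σN σM z)) :
    GrMod.GradedMoritaEquivalent (FinGraph.Leavitt.grading k E) (FinGraph.Leavitt.grading k F) ∧
      GrMod.IsGradedEquivMod (FinGraph.Leavitt.grading k E) (FinGraph.Leavitt.grading k F)
        (Bimodule.tensorFunctor (Bimodule.bridging hF M σM)) :=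
  -- M is placed in degree 0 and N in degree `n.natPred + 1`, which is n. Both composites only need
  -- the sum of these degrees to be n, so one choice serves for E and for F.
  (Bimodule.bridgingGrading hF σM 0).isGradedEquiv_tensorFunctor
    (Bimodule.bridgingGrading hE σN (n.natPred + 1))
    FinGraph.Leavitt.iSup_grading FinGraph.Leavitt.iSup_grading
    (Bimodule.bridgingComposite hE hF ωE σM σN hωE) (Bimodule.bridgingComposite hF hE ωF σN σM hωF)
    (fun hy hz => Bimodule.bridgingComposite_mem hF hE ωE σM σN hωE (by ring) hy hz)
    (fun hz hy => Bimodule.bridgingComposite_mem hE hF ωF σN σM hωF (by ring) hz hy)
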